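/- Let $d,n\ge 1$ be integers and $\mathcal V=\{1,\dots,n\}$. Let $\mathcal P_2(\mathbb R^d)$ be the set of Borel probability measures on $\mathbb R^d$ with finite second moment. For $p\ge 1$ let $$W_p(\mu,\nu)=\inf_{\gamma}\Big(\int_{\mathbb R^d\times\mathbb R^d}|x-y|^p\,d\gamma(x,y)\Big)^{1/p},$$ the infimum being over all probability measures $\gamma$ on $\mathbb R^d\times\mathbb R^d$ with marginals $\mu$ and $\nu$, where $|\cdot|$ is the Euclidean norm. For each time $t\in\{0,1,2,\dots\}$ let $\mathcal E(t)\subset\mathcal V\times\mathcal V$ be a symmetric set of links with $(i,i)\in\mathcal E(t)$ for all $i\in\mathcal V$, let $\mathcal N_i(t)=\{j\in\mathcal V:(i,j)\in\mathcal E(t)\}$, and let $(w_{ij}(t))_{i,j\in\mathcal V}$ be a real matrix with $w_{ij}(t)>0$ if $j\in\mathcal N_i(t)$, $w_{ij}(t)=0$ otherwise, and $\sum_{j\in\mathcal N_i(t)}w_{ij}(t)=1$ for all $i$. Assume that - there is a $\delta\in(0,1)$ such that $w_{ij}(t)\ge\delta$ for all $t$, all $i\in\mathcal V$ and all $j\in\mathcal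 N_i(t)$; - there are integers $0=\tau_0<\tau_1<\tau_2<\cdots$ with $\sup_k(\tau_{k+1}-\tau_k)<\infty$ such that for every $k\ge 0$ the graph with vertex set $\mathcal V$ and link set $\bigcup_{t=\tau_k}^{\tau_{k+1}-1}\mathcal E(t)$ is connected. Let $\mu_1(0),\dots,\mu_n(0)\in\mathcal P_2(\mathbb R^d)$ be absolutely continuous with respect to Lebesgue measure, and suppose that for all $i\in\mathcal V$ and $t\ge 0$ the measure $\mu_i(t+1)$ is a Wasserstein barycenter of the measures $\mu_j(t)$ with weights $w_{ij}(t)$, $j\in\mathcal N_i(t)$, that is, $$\mu_i(t+1)\in\operatorname*{argmin}_{\nu\in\mathcal P_2(\mathbb R^d)}\ \sum_{j\in\mathcal N_i(t)}w_{ij}(t)\,W_2^2(\mu_j(t),\nu).$$ Then $\lim_{t\to\infty}W_2(\mu_i(t),\mu_j(t))=0$ for all $i,j\in\mathcal V$. Moreover, there exists $\mu^*\in\mathcal P_2(\mathbb R^d)$ such that $\lim_{t\to\infty}W_p(\mu_i(t),\mu^*)=0$ for all $i\in\mathcal V$ and all $p\in[1,2)$. -/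

import Mathlib

open MeasureTheory Filter Topology
open scoped ENNReal

namespace WassersteinConsensus

/-- The probability measures on `ℝ^d` with finite `p`-th moment. -/
def PSpace (d : ℕ) (p : ℝ) : Set (ProbabilityMeasure (EuclideanSpace ℝ (Fin d))) :=
  {μ | ∫⁻ x, ‖x‖ₑ ^ p ∂(μ : Measure (EuclideanSpace ℝ (Fin d))) < ∞}

/-- The Lebesgue-absolutely continuous probability measures on `ℝ^d` with finite `p`-th moment. -/
def PSpaceAC (d : ℕ) (p : ℝ) : Set (ProbabilityMeasure (EuclideanSpace ℝ (Fin d))) :=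
  {μ | μ ∈ PSpace d p ∧ (μ : Measure (EuclideanSpace ℝ (Fin d))) ≪ volume}

/-- The transport plans from `μ` to `ν`: probability measures on `ℝ^d × ℝ^d` with first
marginal `μ` and second marginal `ν`. -/
def transportPlans {d : ℕ} (μ ν : ProbabilityMeasure (EuclideanSpace ℝ (Fin d))) :
    Set (ProbabilityMeasure (EuclideanSpace ℝ (Fin d) × EuclideanSpace ℝ (Fin d))) :=
  {γ | (γ : Measure (EuclideanSpace ℝ (Fin d) × EuclideanSpace ℝ (Fin d))).map Prod.fst =
        (μ : Measure (EuclideanSpace ℝ (Fin d))) ∧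
      (γ : Measure (EuclideanSpace ℝ (Fin d) × EuclideanSpace ℝ (Fin d))).map Prod.snd =
        (ν : Measure (EuclideanSpace ℝ (Fin d)))}

/-- The `p`-Wasserstein distance, with values in `[0, ∞]` (finite on measures with finite
`p`-th moment). -/
noncomputable def wasserstein {d : ℕ} (p : ℝ)
    (μ ν : ProbabilityMeasure (EuclideanSpace ℝ (Fin d))) : ℝ≥0∞ :=
  ⨅ γ ∈ transportPlans μ ν,
    (∫⁻ z, ‖z.1 - z.2‖ₑ ^ p
      ∂(γ : Measure (EuclideanSpace ℝ (Fin d) × EuclideanSpace ℝ (Fin d)))) ^ (1 / p)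

/-- The objective `ν ↦ ∑_{j ∈ s} c_j W_2(μ_j, ν)^2` of the barycenter problem. -/
noncomputable def barycenterCost {d : ℕ} {ι : Type*} (s : Finset ι)
    (μ : ι → ProbabilityMeasure (EuclideanSpace ℝ (Fin d))) (c : ι → ℝ)
    (ν : ProbabilityMeasure (EuclideanSpace ℝ (Fin d))) : ℝ≥0∞ :=
  ∑ j ∈ s, ENNReal.ofReal (c j) * wasserstein 2 (μ j) ν ^ 2

/-- The set of weighted Wasserstein barycenters of `(μ_j, c_j)`, `j ∈ s`: the minimizers over
`P_2(ℝ^d)` of the cost above. -/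
def barycenters {d : ℕ} {ι : Type*} (s : Finset ι)
    (μ : ι → ProbabilityMeasure (EuclideanSpace ℝ (Fin d))) (c : ι → ℝ) :
    Set (ProbabilityMeasure (EuclideanSpace ℝ (Fin d))) :=
  {ν | ν ∈ PSpace d 2 ∧ IsMinOn (barycenterCost s μ c) (PSpace d 2) ν}

/-- An undirected network graph on `n` agents in which every agent is linked to itself. -/
structure NetworkGraph (n : ℕ) where
  links : Set (Fin n × Fin n)
  symm : ∀ i j, (i, j) ∈ links → (j, i) ∈ links
  self_mem : ∀ i, (i, i) ∈ links

open Classical in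
/-- The neighbors of agent `i`, including `i` itself. -/
noncomputable def NetworkGraph.neighbors {n : ℕ} (G : NetworkGraph n) (i : Fin n) :
    Finset (Fin n) :=
  Finset.univ.filter fun j => (i, j) ∈ G.links

/-- A collection of network graphs is jointly connected if the graph with the union of their
link sets is connected (self-links play no role here). -/
def JointlyConnected {n : ℕ} (C : Set (NetworkGraph n)) : Prop :=
  (SimpleGraph.fromRel fun i j : Fin n => (i, j) ∈ ⋃ G ∈ C, G.links).Connected

/-- `w` is a weighted adjacency matrix of `G`: positive exactly on links, zero elsewhere, with
the weights of the neighbors of each agent summing to one. -/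
def IsWeightedAdjacency {n : ℕ} (G : NetworkGraph n) (w : Matrix (Fin n) (Fin n) ℝ) : Prop :=
  (∀ i j, (i, j) ∈ G.links ↔ 0 < w i j) ∧ (∀ i j, (i, j) ∉ G.links → w i j = 0) ∧
    ∀ i, ∑ j ∈ G.neighbors i, w i j = 1

end WassersteinConsensus

/-! A Wasserstein barycenter is, up to an arbitrarily small L² error, the law of a weighted average
of coupled variables with the given laws. Indeed, glue near-optimal plans from each `μ j` to `ν`
along their common marginal, giving `X j ∼ μ j` and `Y ∼ ν`, and let `Z = ∑ c j • X j`. Replacing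
`Y` by `Z` lowers the expected weighted cost by exactly `E‖Z - Y‖²`; since `ν` is minimal, this gain
is at most the slack of the plans (`exists_coupling_average`). Jensen's inequality along barycenters
follows (`lintegral_rpow_le_of_mem_barycenters`): for Lipschitz convex `u` and `1 ≤ p ≤ 2`, the
integral of `u₊ ^ p` against the new measure is at most the weighted average of the old integrals.

With `p = 1`, the numbers `∫ u dμ_i(t)` never exceed their neighborhood averages, and such sequences
reach consensus under joint connectivity (`exists_tendsto_of_le_average`). With `p = 2` and `u =
(‖x‖ - R)₊`, tail moments at time `0` bound those at all later times, so second moments are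
uniformly integrable.

Differences of Lipschitz convex functions are closed under maxima, hence contain arbitrarily fine
soft partitions of the space. Every agent asymptotically gives each piece the same mass, so coupling
piece by piece makes the quadratic cost small, the tails being uniformly controlled
(`wasserstein_two_sq_le_of_partition`). Tightness supplies a weak limit point of one agent, and the
same comparison shows that all agents converge to it, in fact in `W₂`. -/

namespace WassersteinConsensus

/-! ### Consensus for sequences dominated by neighborhood averages -/

section Consensus

variable {n : ℕ}

lemma NetworkGraph.mem_neighbors (G : NetworkGraph n) (i j : Fin n) :
    j ∈ G.neighbors i ↔ (i, j) ∈ G.links := by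
  simp [NetworkGraph.neighbors]

lemma IsWeightedAdjacency.pos {G : NetworkGraph n} {w : Matrix (Fin n) (Fin n) ℝ}
    (hw : IsWeightedAdjacency G w) {i j : Fin n} (hj : j ∈ G.neighbors i) : 0 < w i j :=
  (hw.1 i j).1 ((G.mem_neighbors i j).1 hj)

lemma IsWeightedAdjacency.average_le {G : NetworkGraph n} {w : Matrix (Fin n) (Fin n) ℝ}
    (hw : IsWeightedAdjacency G w) {x : Fin n → ℝ} {B : ℝ} (hx : ∀ j, x j ≤ B) (i : Fin n) :
    ∑ j ∈ G.neighbors i, w i j * x j ≤ B := by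
  calc ∑ j ∈ G.neighbors i, w i j * x j ≤ ∑ j ∈ G.neighbors i, w i j * B :=
        Finset.sum_le_sum fun j hj => mul_le_mul_of_nonneg_left (hx j) (hw.pos hj).le
    _ = B := by rw [← Finset.sum_mul, hw.2.2 i, one_mul]

/-- One neighbor lying `D` below the common bound carries weight at least `δ`, so it pulls the whole
average down by at least `δ * D`. -/
lemma IsWeightedAdjacency.average_le_sub {G : NetworkGraph n} {w : Matrix (Fin n) (Fin n) ℝ}
    (hw : IsWeightedAdjacency G w) {δ : ℝ} (hδ : ∀ i, ∀ j ∈ G.neighbors i, δ ≤ w i j)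
    {x : Fin n → ℝ} {B D : ℝ} (hx : ∀ j, x j ≤ B) (hD : 0 ≤ D) {i k : Fin n}
    (hk : k ∈ G.neighbors i) (hxk : x k ≤ B - D) :
    ∑ j ∈ G.neighbors i, w i j * x j ≤ B - δ * D := by
  have h1 : ∑ j ∈ G.neighbors i, w i j * x j + w i k * D
      ≤ ∑ j ∈ G.neighbors i, w i j * B := by
    rw [← Finset.add_sum_erase _ _ hk, ← Finset.add_sum_erase _ (fun j => w i j * B) hk]
    have h2 : ∑ j ∈ (G.neighbors i).erase k, w i j * x j
        ≤ ∑ j ∈ (G.neighbors i).erase k, w i j * B :=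
      Finset.sum_le_sum fun j hj =>
        mul_le_mul_of_nonneg_left (hx j) (hw.pos (Finset.mem_of_mem_erase hj)).le
    have h3 : w i k * x k ≤ w i k * (B - D) := mul_le_mul_of_nonneg_left hxk (hw.pos hk).le
    linarith
  rw [← Finset.sum_mul, hw.2.2 i, one_mul] at h1
  have h4 : δ * D ≤ w i k * D := mul_le_mul_of_nonneg_right (hδ i k hk) hD
  linarith

lemma JointlyConnected.exists_link {C : Set (NetworkGraph n)} (hC : JointlyConnected C)
    {S : Finset (Fin n)} (hS : S.Nonempty) (hS' : S ≠ Finset.univ) :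
    ∃ G ∈ C, ∃ i ∉ S, ∃ j ∈ S, j ∈ G.neighbors i := by
  obtain ⟨u, hu⟩ := hS
  obtain ⟨v, hv⟩ : ∃ v, v ∉ S := by
    by_contra! h
    exact hS' (Finset.eq_univ_of_forall h)
  obtain ⟨p⟩ := hC.preconnected u v
  obtain ⟨e, -, h1, h2⟩ := p.exists_boundary_dart (S : Set (Fin n)) hu hv
  have hadj := e.adj
  rw [SimpleGraph.fromRel_adj] at hadj
  simp only [Set.mem_iUnion, exists_prop] at hadj
  rcases hadj.2 with ⟨H, hH, hl⟩ | ⟨H, hH, hl⟩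
  · exact ⟨H, hH, e.snd, h2, e.fst, h1, (H.mem_neighbors _ _).2 (H.symm _ _ hl)⟩
  · exact ⟨H, hH, e.snd, h2, e.fst, h1, (H.mem_neighbors _ _).2 hl⟩

variable {G : ℕ → NetworkGraph n} {w : ℕ → Matrix (Fin n) (Fin n) ℝ} {δ : ℝ}
  {a : ℕ → Fin n → ℝ}

lemma le_of_le_average (hw : ∀ t, IsWeightedAdjacency (G t) (w t))
    (hstep : ∀ t i, a (t + 1) i ≤ ∑ j ∈ (G t).neighbors i, w t i j * a t j)
    {t : ℕ} {B : ℝ} (h : ∀ j, a t j ≤ B) (r : ℕ) : ∀ j, a (t + r) j ≤ B := by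
  induction r with
  | zero => exact h
  | succ r ih => exact fun j => (hstep _ j).trans ((hw _).average_le ih j)

open Classical in
/-- The agents whose value at time `t + r` has dropped below `B` by at least `δ ^ r * D`. -/
noncomputable def loweredAgents (a : ℕ → Fin n → ℝ) (δ B D : ℝ) (t r : ℕ) : Finset (Fin n) :=
  Finset.univ.filter fun j => a (t + r) j ≤ B - δ ^ r * D

lemma mem_loweredAgents {B D : ℝ} {t r : ℕ} {j : Fin n} :
    j ∈ loweredAgents a δ B D t r ↔ a (t + r) j ≤ B - δ ^ r * D := by
  simp [loweredAgents]

lemma mem_loweredAgents_succ (hw : ∀ t, IsWeightedAdjacency (G t) (w t)) (hδ0 : 0 ≤ δ)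
    (hδ : ∀ t i, ∀ j ∈ (G t).neighbors i, δ ≤ w t i j)
    (hstep : ∀ t i, a (t + 1) i ≤ ∑ j ∈ (G t).neighbors i, w t i j * a t j)
    {t : ℕ} {B D : ℝ} (hD : 0 ≤ D) (h : ∀ j, a t j ≤ B) {r : ℕ} {i k : Fin n}
    (hk : k ∈ (G (t + r)).neighbors i) (hkS : k ∈ loweredAgents a δ B D t r) :
    i ∈ loweredAgents a δ B D t (r + 1) := by
  rw [mem_loweredAgents] at *
  refine (hstep _ i).trans ?_
  rw [pow_succ', mul_assoc]
  exact (hw _).average_le_sub (hδ _) (le_of_le_average hw hstep h r) (by positivity) hk hkS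

lemma loweredAgents_mono (hw : ∀ t, IsWeightedAdjacency (G t) (w t)) (hδ0 : 0 ≤ δ)
    (hδ : ∀ t i, ∀ j ∈ (G t).neighbors i, δ ≤ w t i j)
    (hstep : ∀ t i, a (t + 1) i ≤ ∑ j ∈ (G t).neighbors i, w t i j * a t j)
    {t : ℕ} {B D : ℝ} (hD : 0 ≤ D) (h : ∀ j, a t j ≤ B) :
    Monotone (loweredAgents a δ B D t) :=
  monotone_nat_of_le_succ fun r _ hi =>
    mem_loweredAgents_succ hw hδ0 hδ hstep hD h
      (((G (t + r)).mem_neighbors _ _).2 ((G (t + r)).self_mem _)) hi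

/-- Self-links keep lowered agents lowered, and each connected window contains a link leaving the
lowered set unless that set is everything. So every window adds at least one agent, and `n` windows
suffice. -/
lemma le_card_loweredAgents (hw : ∀ t, IsWeightedAdjacency (G t) (w t)) (hδ0 : 0 ≤ δ)
    (hδ : ∀ t i, ∀ j ∈ (G t).neighbors i, δ ≤ w t i j)
    (hstep : ∀ t i, a (t + 1) i ≤ ∑ j ∈ (G t).neighbors i, w t i j * a t j)
    {τ : ℕ → ℕ} (hτ : StrictMono τ)
    (hconn : ∀ k, JointlyConnected (G '' Set.Ico (τ k) (τ (k + 1))))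
    {t : ℕ} {B D : ℝ} (hD : 0 ≤ D) (h : ∀ j, a t j ≤ B) {i : Fin n} (hi : a t i ≤ B - D)
    {k : ℕ} (hk : t ≤ τ k) (m : ℕ) :
    min n (m + 1) ≤ (loweredAgents a δ B D t (τ (k + m) - t)).card := by
  have hmono := loweredAgents_mono hw hδ0 hδ hstep hD h
  have hne : ∀ r, (loweredAgents a δ B D t r).Nonempty := fun r =>
    ⟨i, hmono (Nat.zero_le r) (by simpa [mem_loweredAgents] using hi)⟩
  induction m with
  | zero => exact (min_le_right _ _).trans (Finset.card_pos.2 (hne _))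
  | succ m ih =>
    have hle : t ≤ τ (k + m) := hk.trans (hτ.monotone (Nat.le_add_right _ _))
    have hlt : τ (k + m) < τ (k + m + 1) := hτ (Nat.lt_succ_self _)
    by_cases hu : loweredAgents a δ B D t (τ (k + m) - t) = Finset.univ
    · have h2 := Finset.card_le_card (hmono
        (show τ (k + m) - t ≤ τ (k + (m + 1)) - t by rw [← add_assoc]; omega))
      rw [hu, Finset.card_univ, Fintype.card_fin] at h2
      exact (min_le_left _ _).trans h2
    -- The set is frozen at the start of the window; `j` is still lowered at the time `s` of the
    -- crossing link, so `i'` is lowered at time `s + 1`, no later than the end of the window.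
    · obtain ⟨H, ⟨s, ⟨hs1, hs2⟩, rfl⟩, i', hi', j, hj, hl⟩ :=
        (hconn (k + m)).exists_link (hne _) hu
      have hs : s = t + (s - t) := by omega
      rw [hs] at hl
      have hi'' := mem_loweredAgents_succ hw hδ0 hδ hstep hD h hl
        (hmono (show τ (k + m) - t ≤ s - t by omega) hj)
      have hins : insert i' (loweredAgents a δ B D t (τ (k + m) - t))
          ⊆ loweredAgents a δ B D t (τ (k + (m + 1)) - t) := by
        refine Finset.insert_subset (hmono ?_ hi'') (hmono ?_)
        · rw [← add_assoc]; omega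
        · rw [← add_assoc]; omega
      have h2 := Finset.card_le_card hins
      rw [Finset.card_insert_of_notMem hi'] at h2
      omega

lemma exists_le_le_add {τ : ℕ → ℕ} (hτ0 : τ 0 = 0) (hτ : StrictMono τ) {L : ℕ}
    (hL : ∀ k, τ (k + 1) - τ k ≤ L) (t : ℕ) : ∃ k, t ≤ τ k ∧ τ k ≤ t + L := by
  induction t with
  | zero => exact ⟨0, by omega, by omega⟩
  | succ t ih =>
    obtain ⟨k, h1, h2⟩ := ih
    by_cases h : t + 1 ≤ τ k
    · exact ⟨k, h, by omega⟩
    · have := hL k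
      have := hτ (Nat.lt_succ_self k)
      simp only [Nat.succ_eq_add_one] at this
      exact ⟨k + 1, by omega, by omega⟩

/-- Agents that never exceed the weighted average of their neighbors over a jointly connected
network reach consensus. -/
theorem exists_tendsto_of_le_average (hn : 0 < n)
    (hw : ∀ t, IsWeightedAdjacency (G t) (w t)) (hδ0 : 0 < δ)
    (hδ : ∀ t i, ∀ j ∈ (G t).neighbors i, δ ≤ w t i j)
    {τ : ℕ → ℕ} (hτ0 : τ 0 = 0) (hτ : StrictMono τ) {L : ℕ} (hL : ∀ k, τ (k + 1) - τ k ≤ L)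
    (hconn : ∀ k, JointlyConnected (G '' Set.Ico (τ k) (τ (k + 1))))
    (ha : ∀ t i, 0 ≤ a t i)
    (hstep : ∀ t i, a (t + 1) i ≤ ∑ j ∈ (G t).neighbors i, w t i j * a t j) :
    ∃ M, ∀ i, Tendsto (fun t => a t i) atTop (𝓝 M) := by
  have : Nonempty (Fin n) := ⟨⟨0, hn⟩⟩
  set U : ℕ → ℝ := fun t => Finset.univ.sup' Finset.univ_nonempty (a t) with hU
  have hle : ∀ t i, a t i ≤ U t := fun t i => Finset.le_sup' (a t) (Finset.mem_univ i)
  have hUle : ∀ {t B}, (∀ i, a t i ≤ B) → U t ≤ B := fun h => Finset.sup'_le _ _ fun i _ => h i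
  have hanti : Antitone U := antitone_nat_of_succ_le fun t =>
    hUle (le_of_le_average hw hstep (hle t) 1)
  have hbdd : BddBelow (Set.range U) := ⟨0, by
    rintro _ ⟨t, rfl⟩
    exact (ha t ⟨0, hn⟩).trans (hle t _)⟩
  have hlim := tendsto_atTop_ciInf hanti hbdd
  set M := ⨅ t, U t
  refine ⟨M, fun i => ?_⟩
  -- At most `L` steps to reach the next window start, then `n` windows of length at most `L`.
  set T := L + n * L
  have hτL : ∀ k m, τ (k + m) ≤ τ k + m * L := by
    intro k m
    induction m with
    | zero => simp
    | succ m ih =>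
      have := hL (k + m)
      rw [← add_assoc, Nat.succ_mul]
      omega
  -- By time `t + T` every agent has dropped by `δ ^ T` times the gap of agent `i`, hence so has the
  -- maximum. Since the maximum converges, the gap must vanish.
  have key : ∀ t, U t - a t i ≤ δ⁻¹ ^ T * (U t - U (t + T)) := by
    intro t
    have hD : 0 ≤ U t - a t i := sub_nonneg.2 (hle t i)
    obtain ⟨k, hk1, hk2⟩ := exists_le_le_add hτ0 hτ hL t
    have hcard := le_card_loweredAgents hw hδ0.le hδ hstep hτ hconn hD (hle t)
      (i := i) (by linarith) hk1 n
    rw [min_eq_left (Nat.le_succ n)] at hcard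
    have huniv : loweredAgents a δ (U t) (U t - a t i) t (τ (k + n) - t) = Finset.univ :=
      Finset.eq_univ_of_card _ (le_antisymm (Finset.card_le_univ _) (by simpa using hcard))
    have hT : τ (k + n) - t ≤ T := by have := hτL k n; omega
    have hlow : ∀ j, a (t + T) j ≤ U t - δ ^ T * (U t - a t i) := fun j =>
      mem_loweredAgents.1 (loweredAgents_mono hw hδ0.le hδ hstep hD (hle t) hT
        (huniv ▸ Finset.mem_univ j))
    have h3 := hUle hlow
    have hp : 0 < δ ^ T := by positivity
    rw [inv_pow, inv_mul_eq_div, le_div_iff₀ hp]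
    linarith
  have h0 : Tendsto (fun t => δ⁻¹ ^ T * (U t - U (t + T))) atTop (𝓝 0) := by
    have := (hlim.sub ((tendsto_add_atTop_iff_nat T).2 hlim)).const_mul (δ⁻¹ ^ T)
    simpa using this
  have h1 : Tendsto (fun t => U t - a t i) atTop (𝓝 0) :=
    squeeze_zero (fun t => sub_nonneg.2 (hle t i)) key h0
  simpa using hlim.sub h1

end Consensus

/-! ### Gluing couplings along a common marginal -/

section Gluing

open ProbabilityTheory

/-- The new coordinate is drawn from the conditional law under `ρ` given `Y`, which leaves the space
already built untouched; this is the inductive step of gluing. -/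
lemma map_compProd_comap_condKernel {Ω X F : Type*} [MeasurableSpace Ω] [MeasurableSpace X]
    [MeasurableSpace F] [StandardBorelSpace F] [Nonempty F] {P : Measure Ω}
    [IsProbabilityMeasure P] {Y : Ω → X} (hY : Measurable Y) {ρ : Measure (X × F)}
    [IsFiniteMeasure ρ] (hρ : ρ.fst = P.map Y) :
    (P ⊗ₘ (ρ.condKernel.comap Y hY)).map (fun q => (Y q.1, q.2)) = ρ := by
  ext A hA
  rw [Measure.map_apply (by fun_prop) hA, Measure.compProd_apply (by measurability)]
  conv_rhs => rw [← ρ.disintegrate ρ.condKernel, Measure.compProd_apply hA, hρ]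
  rw [lintegral_map (Kernel.measurable_kernel_prodMk_left hA) hY]
  rfl

/-- Finitely many couplings with a common second marginal can be realized on one probability
space with a common second coordinate. -/
lemma exists_gluing {ι X F : Type} [MeasurableSpace X] [MeasurableSpace F]
    [StandardBorelSpace F] [Nonempty F] (ν : Measure X) [IsProbabilityMeasure ν] (s : Finset ι)
    (γ : ι → Measure (F × X)) [∀ j, IsFiniteMeasure (γ j)] (hγ : ∀ j ∈ s, (γ j).snd = ν) :
    ∃ (Ω : Type) (_ : MeasurableSpace Ω) (P : Measure Ω) (_ : IsProbabilityMeasure P)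
      (Y : Ω → X) (Z : ι → Ω → F), Measurable Y ∧ (∀ j, Measurable (Z j)) ∧ P.map Y = ν ∧
      ∀ j ∈ s, P.map (fun ω => (Z j ω, Y ω)) = γ j := by
  classical
  induction s using Finset.induction_on with
  | empty =>
    exact ⟨X, inferInstance, ν, inferInstance, id, fun _ _ => Classical.arbitrary F,
      measurable_id, fun _ => measurable_const, Measure.map_id, by simp⟩
  | insert i s his ih =>
    obtain ⟨Ω, _, P, _, Y, Z, hY, hZ, hPY, hPZ⟩ :=
      ih fun j hj => hγ j (Finset.mem_insert_of_mem hj)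
    have hi := hγ i (Finset.mem_insert_self i s)
    -- Disintegration conditions on the first coordinate, while the shared marginal is the second,
    -- hence the swap.
    set ρ := (γ i).map Prod.swap with hρ
    have hρfst : ρ.fst = P.map Y := by rw [hρ, Measure.fst_map_swap, hi, hPY]
    set κ := ρ.condKernel.comap Y hY
    have hfst : (P ⊗ₘ κ).map Prod.fst = P := Measure.fst_compProd P κ
    refine ⟨Ω × F, inferInstance, P ⊗ₘ κ, inferInstance, Y ∘ Prod.fst,
      fun j => if j = i then Prod.snd else Z j ∘ Prod.fst, by fun_prop, fun j => ?_, ?_,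
      fun j hj => ?_⟩
    · by_cases hji : j = i
      · simpa [hji] using measurable_snd
      · simpa [hji] using (hZ j).comp measurable_fst
    · rw [← Measure.map_map hY measurable_fst, hfst, hPY]
    · by_cases hji : j = i
      · subst hji
        have h := congrArg (Measure.map Prod.swap) (map_compProd_comap_condKernel hY hρfst)
        have hswap : ρ.map Prod.swap = γ j := by
          rw [hρ, Measure.map_map measurable_swap measurable_swap, Prod.swap_swap_eq,
            Measure.map_id]
        rw [Measure.map_map measurable_swap (by fun_prop), hswap] at h
        simpa [Function.comp_def] using h
      · rw [← hPZ j (Finset.mem_of_mem_insert_of_ne hj hji)]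
        simp only [hji, if_false]
        conv_rhs => rw [← hfst]
        rw [Measure.map_map (by fun_prop) measurable_fst]
        rfl

end Gluing

/-! ### Elementary estimates for the Wasserstein distance -/

section Wasserstein

variable {d : ℕ}

lemma wasserstein_rpow_le {p : ℝ} (hp : 0 < p)
    {μ ν : ProbabilityMeasure (EuclideanSpace ℝ (Fin d))}
    {γ : ProbabilityMeasure (EuclideanSpace ℝ (Fin d) × EuclideanSpace ℝ (Fin d))}
    (hγ : γ ∈ transportPlans μ ν) :
    wasserstein p μ ν ^ p ≤ ∫⁻ z, ‖z.1 - z.2‖ₑ ^ p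
      ∂(γ : Measure (EuclideanSpace ℝ (Fin d) × EuclideanSpace ℝ (Fin d))) := by
  rw [← ENNReal.le_rpow_inv_iff hp, ← one_div]
  exact iInf₂_le γ hγ

lemma wasserstein_two_sq_le_of_map {Ω : Type*} [MeasurableSpace Ω] {P : Measure Ω}
    [IsProbabilityMeasure P] {μ ν : ProbabilityMeasure (EuclideanSpace ℝ (Fin d))}
    {X Y : Ω → EuclideanSpace ℝ (Fin d)} (hX : Measurable X) (hY : Measurable Y)
    (hXμ : P.map X = μ) (hYν : P.map Y = ν) :
    wasserstein 2 μ ν ^ 2 ≤ ∫⁻ ω, ‖X ω - Y ω‖ₑ ^ 2 ∂P := by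
  have hXY : Measurable fun ω => (X ω, Y ω) := hX.prodMk hY
  have hγ : (⟨P.map fun ω => (X ω, Y ω), Measure.isProbabilityMeasure_map hXY.aemeasurable⟩ :
      ProbabilityMeasure (EuclideanSpace ℝ (Fin d) × EuclideanSpace ℝ (Fin d)))
      ∈ transportPlans μ ν := by
    refine ⟨?_, ?_⟩
    · rw [← hXμ, ProbabilityMeasure.coe_mk, Measure.map_map measurable_fst hXY]; rfl
    · rw [← hYν, ProbabilityMeasure.coe_mk, Measure.map_map measurable_snd hXY]; rfl
  have h := wasserstein_rpow_le two_pos hγ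
  simp only [ENNReal.rpow_two, ProbabilityMeasure.coe_mk] at h
  rwa [lintegral_map (by fun_prop) hXY] at h

/-- Near-optimal plans are enough for the barycenter argument, which makes the existence of optimal
plans unnecessary. -/
lemma exists_plan_le {μ ν : ProbabilityMeasure (EuclideanSpace ℝ (Fin d))}
    (h : wasserstein 2 μ ν ≠ ∞) {η : ℝ≥0∞} (hη : η ≠ 0) :
    ∃ γ ∈ transportPlans μ ν, ∫⁻ z, ‖z.1 - z.2‖ₑ ^ 2
      ∂(γ : Measure (EuclideanSpace ℝ (Fin d) × EuclideanSpace ℝ (Fin d)))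
      ≤ wasserstein 2 μ ν ^ 2 + η := by
  by_contra! hcon
  have h1 : (wasserstein 2 μ ν ^ 2 + η) ^ (1 / 2 : ℝ) ≤ wasserstein 2 μ ν := by
    refine le_iInf₂ fun γ hγ => ENNReal.rpow_le_rpow ?_ (by norm_num)
    simpa using (hcon γ hγ).le
  rw [one_div, ENNReal.rpow_inv_le_iff two_pos, ENNReal.rpow_two] at h1
  exact (ENNReal.lt_add_right (by finiteness) hη).not_ge h1

lemma enorm_sub_sq_le {E : Type*} [NormedAddCommGroup E] (x y : E) :
    ‖x - y‖ₑ ^ 2 ≤ 2 * ‖x‖ₑ ^ 2 + 2 * ‖y‖ₑ ^ 2 := by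
  have h := enorm_sub_le (a := x) (b := y)
  calc ‖x - y‖ₑ ^ 2 ≤ (‖x‖ₑ + ‖y‖ₑ) ^ 2 := by gcongr
    _ ≤ 2 * ‖x‖ₑ ^ 2 + 2 * ‖y‖ₑ ^ 2 := by
      have h2 : (‖x‖ + ‖y‖) ^ 2 ≤ 2 * ‖x‖ ^ 2 + 2 * ‖y‖ ^ 2 := by
        nlinarith [sq_nonneg (‖x‖ - ‖y‖)]
      simp only [← ofReal_norm]
      rw [← ENNReal.ofReal_add (by positivity) (by positivity),
        ← ENNReal.ofReal_pow (by positivity), ← ENNReal.ofReal_pow (by positivity),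
        ← ENNReal.ofReal_pow (by positivity)]
      have h3 : (2 : ℝ≥0∞) = ENNReal.ofReal 2 := by simp
      rw [h3, ← ENNReal.ofReal_mul (by positivity), ← ENNReal.ofReal_mul (by positivity),
        ← ENNReal.ofReal_add (by positivity) (by positivity)]
      exact ENNReal.ofReal_le_ofReal h2

lemma mem_PSpace_two {μ : ProbabilityMeasure (EuclideanSpace ℝ (Fin d))} :
    μ ∈ PSpace d 2 ↔ ∫⁻ x, ‖x‖ₑ ^ 2 ∂(μ : Measure (EuclideanSpace ℝ (Fin d))) < ∞ := by
  simp [PSpace]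

lemma wasserstein_two_ne_top {μ ν : ProbabilityMeasure (EuclideanSpace ℝ (Fin d))}
    (hμ : μ ∈ PSpace d 2) (hν : ν ∈ PSpace d 2) : wasserstein 2 μ ν ≠ ∞ := by
  rw [mem_PSpace_two] at hμ hν
  have h := wasserstein_two_sq_le_of_map (μ := μ) (ν := ν)
    (P := (μ : Measure (EuclideanSpace ℝ (Fin d))).prod ν) measurable_fst measurable_snd
    (by simp) (by simp)
  have h2 : ∫⁻ z, ‖z.1 - z.2‖ₑ ^ 2 ∂((μ : Measure (EuclideanSpace ℝ (Fin d))).prod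
      (ν : Measure (EuclideanSpace ℝ (Fin d)))) < ∞ := by
    have e1 : ∫⁻ z, ‖z.1‖ₑ ^ 2 ∂((μ : Measure (EuclideanSpace ℝ (Fin d))).prod
        (ν : Measure (EuclideanSpace ℝ (Fin d)))) < ∞ := by
      rw [← lintegral_map (f := fun x : EuclideanSpace ℝ (Fin d) => ‖x‖ₑ ^ 2) (by fun_prop)
        measurable_fst]
      simpa using hμ
    have e2 : ∫⁻ z, ‖z.2‖ₑ ^ 2 ∂((μ : Measure (EuclideanSpace ℝ (Fin d))).prod
        (ν : Measure (EuclideanSpace ℝ (Fin d)))) < ∞ := by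
      rw [← lintegral_map (f := fun x : EuclideanSpace ℝ (Fin d) => ‖x‖ₑ ^ 2) (by fun_prop)
        measurable_snd]
      simpa using hν
    refine lt_of_le_of_lt (lintegral_mono (g := fun z => 2 * ‖z.1‖ₑ ^ 2 + 2 * ‖z.2‖ₑ ^ 2)
      fun z => enorm_sub_sq_le z.1 z.2) ?_
    rw [lintegral_add_left (by fun_prop), lintegral_const_mul _ (by fun_prop),
      lintegral_const_mul _ (by fun_prop)]
    finiteness
  intro htop
  rw [htop] at h
  exact absurd (h.trans_lt h2) (by simp)

end Wasserstein

/-! ### Barycenters as laws of averages, and Jensen's inequality -/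

section Barycenter

variable {d : ℕ}

/-- Bias-variance decomposition: the cross terms cancel because the weighted deviations from the
mean sum to zero. -/
lemma sum_mul_norm_sub_sq {E ι : Type*} [NormedAddCommGroup E] [InnerProductSpace ℝ E]
    (s : Finset ι) {c : ι → ℝ} (hc : ∑ j ∈ s, c j = 1) (x : ι → E) (y : E) :
    ∑ j ∈ s, c j * ‖x j - y‖ ^ 2 =
      ∑ j ∈ s, c j * ‖x j - ∑ k ∈ s, c k • x k‖ ^ 2 + ‖∑ k ∈ s, c k • x k - y‖ ^ 2 := by
  set z := ∑ k ∈ s, c k • x k with hz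
  have h1 : ∀ j, c j * ‖x j - y‖ ^ 2 =
      c j * ‖x j - z‖ ^ 2 + 2 * inner ℝ (c j • (x j - z)) (z - y) + c j * ‖z - y‖ ^ 2 := by
    intro j
    rw [← sub_add_sub_cancel (x j) z y, norm_add_sq_real, real_inner_smul_left]
    ring
  have h2 : ∑ j ∈ s, c j • (x j - z) = 0 := by
    simp_rw [smul_sub]
    rw [Finset.sum_sub_distrib, ← Finset.sum_smul, hc, one_smul, ← hz, sub_self]
  simp_rw [h1]
  rw [Finset.sum_add_distrib, Finset.sum_add_distrib, ← Finset.mul_sum, ← sum_inner, h2,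
    inner_zero_left, ← Finset.sum_mul, hc]
  ring

lemma sum_ofReal_mul_enorm_sub_sq {E ι : Type*} [NormedAddCommGroup E] [InnerProductSpace ℝ E]
    (s : Finset ι) {c : ι → ℝ} (hc0 : ∀ j ∈ s, 0 ≤ c j) (hc : ∑ j ∈ s, c j = 1) (x : ι → E)
    (y : E) :
    ∑ j ∈ s, ENNReal.ofReal (c j) * ‖x j - y‖ₑ ^ 2 =
      ∑ j ∈ s, ENNReal.ofReal (c j) * ‖x j - ∑ k ∈ s, c k • x k‖ₑ ^ 2
        + ‖∑ k ∈ s, c k • x k - y‖ₑ ^ 2 := by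
  have key : ∀ z : E, ∑ j ∈ s, ENNReal.ofReal (c j) * ‖x j - z‖ₑ ^ 2 =
      ENNReal.ofReal (∑ j ∈ s, c j * ‖x j - z‖ ^ 2) := by
    intro z
    rw [ENNReal.ofReal_sum_of_nonneg fun j hj => mul_nonneg (hc0 j hj) (by positivity)]
    refine Finset.sum_congr rfl fun j hj => ?_
    rw [ENNReal.ofReal_mul (hc0 j hj), ENNReal.ofReal_pow (norm_nonneg _), ofReal_norm]
  rw [key, key, ← ofReal_norm (_ - y), ← ENNReal.ofReal_pow (norm_nonneg _),
    ← ENNReal.ofReal_add (Finset.sum_nonneg fun j hj => mul_nonneg (hc0 j hj) (by positivity))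
      (by positivity), sum_mul_norm_sub_sq s hc]

lemma sum_ofReal_eq_one {ι : Type*} {s : Finset ι} {c : ι → ℝ} (hc0 : ∀ j ∈ s, 0 ≤ c j)
    (hc : ∑ j ∈ s, c j = 1) : ∑ j ∈ s, ENNReal.ofReal (c j) = 1 := by
  rw [← ENNReal.ofReal_sum_of_nonneg hc0, hc, ENNReal.ofReal_one]

/-- A Wasserstein barycenter is approximately the law of the weighted average of suitably coupled
random variables distributed according to the given measures. -/
lemma exists_coupling_average {ι : Type} {s : Finset ι}
    {μ : ι → ProbabilityMeasure (EuclideanSpace ℝ (Fin d))} {c : ι → ℝ}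
    (hc0 : ∀ j ∈ s, 0 ≤ c j) (hc : ∑ j ∈ s, c j = 1) (hμ : ∀ j ∈ s, μ j ∈ PSpace d 2)
    {ν : ProbabilityMeasure (EuclideanSpace ℝ (Fin d))} (hν : ν ∈ barycenters s μ c)
    {η : ℝ≥0∞} (hη : η ≠ 0) (hη' : η ≠ ∞) :
    ∃ (Ω : Type) (_ : MeasurableSpace Ω) (P : Measure Ω) (_ : IsProbabilityMeasure P)
      (Y : Ω → EuclideanSpace ℝ (Fin d)) (X : ι → Ω → EuclideanSpace ℝ (Fin d)),
      Measurable Y ∧ (∀ j, Measurable (X j)) ∧ P.map Y = ν ∧ (∀ j ∈ s, P.map (X j) = μ j) ∧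
      ∫⁻ ω, ‖∑ j ∈ s, c j • X j ω - Y ω‖ₑ ^ 2 ∂P ≤ η := by
  classical
  have hW : ∀ j ∈ s, wasserstein 2 (μ j) ν ≠ ∞ := fun j hj =>
    wasserstein_two_ne_top (hμ j hj) hν.1
  have hplan : ∀ j, ∃ γ : ProbabilityMeasure
      (EuclideanSpace ℝ (Fin d) × EuclideanSpace ℝ (Fin d)),
      j ∈ s → γ ∈ transportPlans (μ j) ν ∧ ∫⁻ z, ‖z.1 - z.2‖ₑ ^ 2
        ∂(γ : Measure (EuclideanSpace ℝ (Fin d) × EuclideanSpace ℝ (Fin d)))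
        ≤ wasserstein 2 (μ j) ν ^ 2 + η := by
    intro j
    by_cases hj : j ∈ s
    · obtain ⟨γ, h1, h2⟩ := exists_plan_le (hW j hj) hη
      exact ⟨γ, fun _ => ⟨h1, h2⟩⟩
    -- Arbitrary value for indices outside `s`; no property of it is used.
    · exact ⟨⟨Measure.dirac 0, inferInstance⟩, fun h => absurd h hj⟩
  choose γ hγ using hplan
  obtain ⟨Ω, _, P, hP, Y, X, hY, hX, hPY, hPX⟩ := exists_gluing
    (ν : Measure (EuclideanSpace ℝ (Fin d))) s
    (fun j => (γ j : Measure (EuclideanSpace ℝ (Fin d) × EuclideanSpace ℝ (Fin d))))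
    (fun j hj => (hγ j hj).1.2)
  have hXμ : ∀ j ∈ s, P.map (X j) = μ j := by
    intro j hj
    rw [← (hγ j hj).1.1, ← hPX j hj, Measure.map_map measurable_fst ((hX j).prodMk hY)]
    rfl
  refine ⟨Ω, _, P, hP, Y, X, hY, hX, hPY, hXμ, ?_⟩
  set Z : Ω → EuclideanSpace ℝ (Fin d) := fun ω => ∑ j ∈ s, c j • X j ω with hZdef
  have hZ : Measurable Z := Finset.measurable_fun_sum _ fun j _ => (hX j).const_smul (c j)
  let ζ : ProbabilityMeasure (EuclideanSpace ℝ (Fin d)) :=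
    ⟨P.map Z, Measure.isProbabilityMeasure_map hZ.aemeasurable⟩
  have hXY : ∀ j ∈ s, ∫⁻ ω, ‖X j ω - Y ω‖ₑ ^ 2 ∂P ≤ wasserstein 2 (μ j) ν ^ 2 + η := by
    intro j hj
    refine le_of_eq_of_le ?_ (hγ j hj).2
    rw [← hPX j hj, lintegral_map (by fun_prop) ((hX j).prodMk hY)]
  have hsum := lintegral_congr (μ := P) fun ω =>
    sum_ofReal_mul_enorm_sub_sq s hc0 hc (fun j => X j ω) (Y ω)
  rw [lintegral_add_left (Finset.measurable_fun_sum _ fun j _ => by fun_prop),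
    lintegral_finsetSum _ fun j _ => by fun_prop,
    lintegral_finsetSum _ fun j _ => by fun_prop] at hsum
  simp_rw [lintegral_const_mul' _ _ ENNReal.ofReal_ne_top] at hsum
  set A := ∑ j ∈ s, ENNReal.ofReal (c j) * ∫⁻ ω, ‖X j ω - Z ω‖ₑ ^ 2 ∂P with hA
  have hle : ∑ j ∈ s, ENNReal.ofReal (c j) * ∫⁻ ω, ‖X j ω - Y ω‖ₑ ^ 2 ∂P
      ≤ barycenterCost s μ c ν + η := by
    calc _ ≤ ∑ j ∈ s, ENNReal.ofReal (c j) * (wasserstein 2 (μ j) ν ^ 2 + η) :=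
          Finset.sum_le_sum fun j hj => mul_le_mul_right (hXY j hj) _
      _ = _ := by
        simp_rw [mul_add]
        rw [Finset.sum_add_distrib, ← Finset.sum_mul, sum_ofReal_eq_one hc0 hc, one_mul]
        rfl
  have hcost : barycenterCost s μ c ν ≠ ∞ := by
    refine (ENNReal.sum_lt_top.2 fun j hj => ?_).ne
    have := hW j hj
    finiteness
  have hYY : ∫⁻ ω, ‖Y ω‖ₑ ^ 2 ∂P < ∞ := by
    have := mem_PSpace_two.1 hν.1
    rwa [← hPY, lintegral_map (by fun_prop) hY] at this
  have hZY : ∫⁻ ω, ‖Z ω - Y ω‖ₑ ^ 2 ∂P ≤ barycenterCost s μ c ν + η :=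
    (le_add_self.trans hsum.ge).trans hle
  -- The law of `Z` must have finite second moment to compete with `ν` in the minimization.
  have hζ : ζ ∈ PSpace d 2 := by
    rw [mem_PSpace_two]
    change ∫⁻ x, ‖x‖ₑ ^ 2 ∂(P.map Z) < ∞
    rw [lintegral_map (by fun_prop) hZ]
    have h1 : ∀ ω, ‖Z ω‖ₑ ^ 2 ≤ 2 * ‖Z ω - Y ω‖ₑ ^ 2 + 2 * ‖Y ω‖ₑ ^ 2 := fun ω => by
      simpa using enorm_sub_sq_le (Z ω - Y ω) (-Y ω)
    refine (lintegral_mono h1).trans_lt ?_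
    rw [lintegral_add_left (by fun_prop), lintegral_const_mul _ (by fun_prop),
      lintegral_const_mul _ (by fun_prop)]
    have : ∫⁻ ω, ‖Z ω - Y ω‖ₑ ^ 2 ∂P ≠ ∞ := ne_top_of_le_ne_top (by finiteness) hZY
    finiteness
  have hmin : barycenterCost s μ c ν ≤ A := by
    refine (hν.2 hζ).trans (Finset.sum_le_sum fun j hj => mul_le_mul_right ?_ _)
    exact wasserstein_two_sq_le_of_map (hX j) hZ (hXμ j hj) rfl
  have hAtop : A ≠ ∞ := by
    refine ne_top_of_le_ne_top (b := barycenterCost s μ c ν + η) (by finiteness) ?_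
    exact (le_self_add.trans hsum.ge).trans hle
  -- The cost of `Y` is `A` plus the squared L² error; it exceeds the minimum by at most `η`, and
  -- the minimum is at most `A`. Cancelling the finite `A` bounds the error by `η`.
  have hfin : A + ∫⁻ ω, ‖Z ω - Y ω‖ₑ ^ 2 ∂P ≤ A + η :=
    (hsum.ge.trans hle).trans (add_le_add_left hmin η)
  exact (ENNReal.add_le_add_iff_left hAtop).1 hfin

/-- Jensen's inequality for Wasserstein barycenters. -/
theorem lintegral_rpow_le_of_mem_barycenters {ι : Type} {s : Finset ι}
    {μ : ι → ProbabilityMeasure (EuclideanSpace ℝ (Fin d))} {c : ι → ℝ}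
    (hc0 : ∀ j ∈ s, 0 ≤ c j) (hc : ∑ j ∈ s, c j = 1) (hμ : ∀ j ∈ s, μ j ∈ PSpace d 2)
    {ν : ProbabilityMeasure (EuclideanSpace ℝ (Fin d))} (hν : ν ∈ barycenters s μ c)
    {u : EuclideanSpace ℝ (Fin d) → ℝ} (hu : ConvexOn ℝ Set.univ u)
    {K : NNReal} (hK : LipschitzWith K u) {p : ℝ} (hp1 : 1 ≤ p) (hp2 : p ≤ 2) :
    ∫⁻ x, ENNReal.ofReal (u x) ^ p ∂(ν : Measure (EuclideanSpace ℝ (Fin d))) ≤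
      ∑ j ∈ s, ENNReal.ofReal (c j) *
        ∫⁻ x, ENNReal.ofReal (u x) ^ p ∂(μ j : Measure (EuclideanSpace ℝ (Fin d))) := by
  have hp0 : 0 < p := by linarith
  have hum : Measurable u := hK.continuous.measurable
  -- Passing to `p`-th roots lets Minkowski's inequality absorb the error between `Y` and `Z`.
  rw [← ENNReal.rpow_le_rpow_iff (one_div_pos.2 hp0)]
  refine ENNReal.le_of_forall_pos_le_add fun ε hε _ => ?_
  -- Chosen so that `K` times the L² error is at most `ε`; `K + 1` avoids dividing by zero.
  set η : ℝ≥0∞ := (((ε / (K + 1)) ^ 2 : NNReal) : ℝ≥0∞) with hη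
  obtain ⟨Ω, _, P, hP, Y, X, hY, hX, hPY, hXμ, hle⟩ := exists_coupling_average hc0 hc hμ hν
    (η := η) (by rw [hη]; exact ENNReal.coe_ne_zero.2 (by positivity)) ENNReal.coe_ne_top
  set Z : Ω → EuclideanSpace ℝ (Fin d) := fun ω => ∑ j ∈ s, c j • X j ω with hZdef
  have hZ : Measurable Z := Finset.measurable_fun_sum _ fun j _ => (hX j).const_smul (c j)
  have h1 : ∀ ω, ENNReal.ofReal (u (Y ω)) ≤
      ENNReal.ofReal (u (Z ω)) + K * ‖Z ω - Y ω‖ₑ := by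
    intro ω
    have h := hK.dist_le_mul (Y ω) (Z ω)
    rw [Real.dist_eq, dist_eq_norm, norm_sub_rev] at h
    have h' : u (Y ω) ≤ u (Z ω) + K * ‖Z ω - Y ω‖ := by
      linarith [le_abs_self (u (Y ω) - u (Z ω))]
    refine (ENNReal.ofReal_le_ofReal h').trans (ENNReal.ofReal_add_le.trans ?_)
    rw [ENNReal.ofReal_mul K.coe_nonneg, ofReal_norm, ENNReal.ofReal_coe_nnreal]
  have h2 : ∀ ω, ENNReal.ofReal (u (Z ω)) ^ p ≤
      ∑ j ∈ s, ENNReal.ofReal (c j) * ENNReal.ofReal (u (X j ω)) ^ p := by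
    intro ω
    have h := hu.map_sum_le (t := s) (w := c) (p := fun j => X j ω) hc0 hc (by simp)
    simp only [smul_eq_mul] at h
    have h' : ENNReal.ofReal (u (Z ω)) ≤
        ∑ j ∈ s, ENNReal.ofReal (c j) * ENNReal.ofReal (u (X j ω)) := by
      refine (ENNReal.ofReal_le_ofReal h).trans ?_
      refine (Finset.le_sum_of_subadditive _ ENNReal.ofReal_zero.le
        (fun _ _ => ENNReal.ofReal_add_le) s _).trans (Finset.sum_le_sum fun j hj => ?_)
      rw [ENNReal.ofReal_mul (hc0 j hj)]
    exact (ENNReal.rpow_le_rpow h' hp0.le).trans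
      (ENNReal.rpow_arith_mean_le_arith_mean_rpow s _ _ (sum_ofReal_eq_one hc0 hc) hp1)
  have h3 : ∫⁻ ω, ENNReal.ofReal (u (Z ω)) ^ p ∂P ≤ ∑ j ∈ s, ENNReal.ofReal (c j) *
        ∫⁻ x, ENNReal.ofReal (u x) ^ p ∂(μ j : Measure (EuclideanSpace ℝ (Fin d))) := by
    refine (lintegral_mono h2).trans (le_of_eq ?_)
    rw [lintegral_finsetSum _ fun j _ => by fun_prop]
    refine Finset.sum_congr rfl fun j hj => ?_
    rw [lintegral_const_mul' _ _ ENNReal.ofReal_ne_top, ← hXμ j hj,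
      lintegral_map (by fun_prop) (hX j)]
  -- On a probability space the L^p norm is at most the L² norm; this is where `p ≤ 2` enters.
  have h4 : (∫⁻ ω, ‖Z ω - Y ω‖ₑ ^ p ∂P) ^ (1 / p) ≤ ((ε / (K + 1) : NNReal) : ℝ≥0∞) := by
    have h := eLpNorm'_le_eLpNorm'_of_exponent_le (f := fun ω => Z ω - Y ω) hp0 hp2 P
      (by fun_prop)
    simp only [eLpNorm'] at h
    refine h.trans ?_
    rw [one_div, ENNReal.rpow_inv_le_iff two_pos]
    simpa [hη] using hle
  rw [← hPY, lintegral_map (by fun_prop) hY]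
  calc (∫⁻ ω, ENNReal.ofReal (u (Y ω)) ^ p ∂P) ^ (1 / p)
      ≤ (∫⁻ ω, ((fun ω => ENNReal.ofReal (u (Z ω))) + fun ω => K * ‖Z ω - Y ω‖ₑ) ω ^ p ∂P)
          ^ (1 / p) := by
        refine ENNReal.rpow_le_rpow (lintegral_mono fun ω => ?_) (by positivity)
        exact ENNReal.rpow_le_rpow (h1 ω) hp0.le
    _ ≤ (∫⁻ ω, ENNReal.ofReal (u (Z ω)) ^ p ∂P) ^ (1 / p)
        + (∫⁻ ω, (K * ‖Z ω - Y ω‖ₑ) ^ p ∂P) ^ (1 / p) :=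
        ENNReal.lintegral_Lp_add_le (by fun_prop) (by fun_prop) hp1
    _ ≤ _ := by
        refine add_le_add (ENNReal.rpow_le_rpow h3 (by positivity)) ?_
        simp_rw [ENNReal.mul_rpow_of_nonneg _ _ hp0.le]
        rw [lintegral_const_mul' _ _ (by finiteness),
          ENNReal.mul_rpow_of_nonneg _ _ (by positivity), ← ENNReal.rpow_mul,
          mul_one_div_cancel hp0.ne', ENNReal.rpow_one]
        refine (mul_le_mul_right h4 _).trans ?_
        rw [← ENNReal.coe_mul, ENNReal.coe_le_coe, mul_div_assoc']
        rw [div_le_iff₀ (by positivity), mul_comm]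
        gcongr
        exact le_self_add

end Barycenter

/-! ### Product couplings of measures of equal mass -/

section NormalizedProduct

variable {X : Type*} [MeasurableSpace X]

/-- The product coupling of two finite measures of equal mass. -/
noncomputable def normalizedProd (α β : Measure X) : Measure (X × X) :=
  (α Set.univ)⁻¹ • α.prod β

lemma map_fst_normalizedProd {α β : Measure X} [IsFiniteMeasure α] [IsFiniteMeasure β]
    (h : α Set.univ = β Set.univ) : (normalizedProd α β).map Prod.fst = α := by
  rw [normalizedProd, Measure.map_smul, Measure.map_fst_prod, ← h, smul_smul]
  -- For zero mass the normalizing factor is `∞`, but it scales the zero measure.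
  by_cases h0 : α Set.univ = 0
  · simp [Measure.measure_univ_eq_zero.1 h0]
  · rw [ENNReal.inv_mul_cancel h0 (measure_ne_top _ _), one_smul]

lemma map_snd_normalizedProd {α β : Measure X} [IsFiniteMeasure α] [IsFiniteMeasure β]
    (h : α Set.univ = β Set.univ) : (normalizedProd α β).map Prod.snd = β := by
  rw [normalizedProd, Measure.map_smul, Measure.map_snd_prod, smul_smul]
  by_cases h0 : α Set.univ = 0
  · simp [Measure.measure_univ_eq_zero.1 (h ▸ h0)]
  · rw [ENNReal.inv_mul_cancel h0 (measure_ne_top _ _), one_smul]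

lemma lintegral_fst_normalizedProd {α β : Measure X} [IsFiniteMeasure α] [IsFiniteMeasure β]
    (h : α Set.univ = β Set.univ) {f : X → ℝ≥0∞} (hf : Measurable f) :
    ∫⁻ z, f z.1 ∂(normalizedProd α β) = ∫⁻ x, f x ∂α := by
  conv_rhs => rw [← map_fst_normalizedProd h]
  rw [lintegral_map hf measurable_fst]

lemma lintegral_snd_normalizedProd {α β : Measure X} [IsFiniteMeasure α] [IsFiniteMeasure β]
    (h : α Set.univ = β Set.univ) {f : X → ℝ≥0∞} (hf : Measurable f) :
    ∫⁻ z, f z.2 ∂(normalizedProd α β) = ∫⁻ x, f x ∂β := by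
  conv_rhs => rw [← map_snd_normalizedProd h]
  rw [lintegral_map hf measurable_snd]

end NormalizedProduct

/-! ### Splitting a measure along a soft partition -/

section SoftPartition

variable {X : Type*} [MeasurableSpace X]

lemma sum_withDensity_add_residual (μ : Measure X) {ι : Type*} (s : Finset ι)
    {φ : ι → X → ℝ≥0∞} (hφ : ∀ k, Measurable (φ k)) (hsum : ∀ x, ∑ k ∈ s, φ k x ≤ 1) :
    ∑ k ∈ s, μ.withDensity (φ k) + μ.withDensity (fun x => 1 - ∑ k ∈ s, φ k x) = μ := by
  ext A hA
  rw [Measure.add_apply, Measure.finsetSum_apply, withDensity_apply _ hA]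
  simp_rw [withDensity_apply _ hA]
  rw [← lintegral_finsetSum _ fun k _ => hφ k, ← lintegral_add_left
    (Finset.measurable_fun_sum _ fun k _ => hφ k)]
  simp_rw [add_tsub_cancel_of_le (hsum _)]
  simp

/-- A probability measure splits into pieces of prescribed masses dominated by the pieces of a
soft partition, and a remainder. -/
lemma exists_split (μ : Measure X) [IsProbabilityMeasure μ] {ι : Type*} (s : Finset ι)
    {ψ : ι → X → ℝ≥0∞} (hψ : ∀ k, Measurable (ψ k)) (hsum : ∀ x, ∑ k ∈ s, ψ k x ≤ 1)
    {c : ι → ℝ≥0∞} (hc : ∀ k ∈ s, c k ≤ ∫⁻ x, ψ k x ∂μ) :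
    ∃ (α : ι → Measure X) (r : Measure X), ∑ k ∈ s, α k + r = μ ∧ IsFiniteMeasure r ∧
      ∀ k ∈ s, IsFiniteMeasure (α k) ∧ α k Set.univ = c k ∧ ∀ᵐ x ∂(α k), ψ k x ≠ 0 := by
  -- The piece with density `q k * ψ k` has mass `c k`. If `ψ k` has zero integral then `c k = 0`,
  -- and the convention `0 / 0 = 0` is the right one.
  set q : ι → ℝ≥0∞ := fun k => c k / ∫⁻ x, ψ k x ∂μ with hq
  have hq1 : ∀ k ∈ s, q k ≤ 1 := fun k hk => ENNReal.div_le_of_le_mul (by simpa using hc k hk)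
  have hψtop : ∀ k ∈ s, ∫⁻ x, ψ k x ∂μ ≠ ∞ := fun k hk => by
    have h : ∫⁻ x, ψ k x ∂μ ≤ ∫⁻ _, 1 ∂μ := lintegral_mono fun x =>
      (Finset.single_le_sum (f := fun k => ψ k x) (fun _ _ => zero_le) hk).trans (hsum x)
    exact ne_top_of_le_ne_top (by simp) h
  have hle : ∀ x, ∑ k ∈ s, q k * ψ k x ≤ 1 := fun x =>
    (Finset.sum_le_sum fun k hk => mul_le_of_le_one_left zero_le (hq1 k hk)).trans (hsum x)
  have hmeas : ∀ k, Measurable fun x => q k * ψ k x := fun k => (hψ k).const_mul _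
  have hsplit := sum_withDensity_add_residual μ s hmeas hle
  refine ⟨_, _, hsplit, ?_, fun k hk => ?_⟩
  · refine ⟨lt_of_le_of_lt ?_ (measure_lt_top μ Set.univ)⟩
    conv_rhs => rw [← hsplit]
    rw [Measure.add_apply]
    exact le_add_self
  · have hmass : μ.withDensity (fun x => q k * ψ k x) Set.univ = c k := by
      rw [withDensity_apply _ .univ, Measure.restrict_univ, lintegral_const_mul _ (hψ k)]
      exact ENNReal.div_mul_cancel' (fun h0 => le_antisymm (h0 ▸ hc k hk) zero_le)
        fun h => absurd h (hψtop k hk)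
    refine ⟨⟨hmass.trans_lt ((hc k hk).trans_lt (hψtop k hk).lt_top)⟩, hmass, ?_⟩
    rw [ae_withDensity_iff (hmeas k)]
    exact Eventually.of_forall fun x hx h0 => hx (by rw [h0, mul_zero])

end SoftPartition

/-! ### Comparing two measures through a soft partition -/

section Coupling

variable {d : ℕ}

/-- The part of the second moment of a measure carried by distances larger than `R`. -/
noncomputable def tailMoment (R : ℝ) (μ : Measure (EuclideanSpace ℝ (Fin d))) : ℝ≥0∞ :=
  ∫⁻ x, ENNReal.ofReal (‖x‖ - R) ^ 2 ∂μ

lemma tailMoment_mono {R : ℝ} {μ ν : Measure (EuclideanSpace ℝ (Fin d))} (h : μ ≤ ν) :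
    tailMoment R μ ≤ tailMoment R ν :=
  lintegral_mono' h le_rfl

/-- Pointwise, either `‖x‖ ≤ 2 * R` or `‖x‖ ≤ 2 * (‖x‖ - R)`. -/
lemma lintegral_enorm_sq_le_tailMoment (R : ℝ)
    (μ : Measure (EuclideanSpace ℝ (Fin d))) :
    ∫⁻ x, ‖x‖ₑ ^ 2 ∂μ ≤ 4 * ENNReal.ofReal R ^ 2 * μ Set.univ + 4 * tailMoment R μ := by
  have h4 : (4 : ℝ≥0∞) = ENNReal.ofReal 2 ^ 2 := by
    rw [← ENNReal.ofReal_pow (by norm_num)]; norm_num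
  have h : ∀ x : EuclideanSpace ℝ (Fin d),
      ‖x‖ₑ ^ 2 ≤ 4 * ENNReal.ofReal R ^ 2 + 4 * ENNReal.ofReal (‖x‖ - R) ^ 2 := by
    intro x
    rw [h4, ← mul_pow, ← mul_pow, ← ENNReal.ofReal_mul (by norm_num),
      ← ENNReal.ofReal_mul (by norm_num), ← ofReal_norm]
    rcases le_total ‖x‖ (2 * R) with h | h
    · exact (pow_le_pow_left₀ zero_le (ENNReal.ofReal_le_ofReal h) 2).trans le_self_add
    · exact (pow_le_pow_left₀ zero_le (ENNReal.ofReal_le_ofReal (by linarith)) 2).trans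
        le_add_self
  refine (lintegral_mono h).trans (le_of_eq ?_)
  rw [lintegral_add_left (by fun_prop), lintegral_const, lintegral_const_mul _ (by fun_prop)]
  rfl

lemma lintegral_normalizedProd_le {α β : Measure (EuclideanSpace ℝ (Fin d))}
    [IsFiniteMeasure α] [IsFiniteMeasure β] (h : α Set.univ = β Set.univ) :
    ∫⁻ z, ‖z.1 - z.2‖ₑ ^ 2 ∂(normalizedProd α β) ≤
      2 * ∫⁻ x, ‖x‖ₑ ^ 2 ∂α + 2 * ∫⁻ x, ‖x‖ₑ ^ 2 ∂β := by
  refine (lintegral_mono (g := fun z => 2 * ‖z.1‖ₑ ^ 2 + 2 * ‖z.2‖ₑ ^ 2)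
    fun z => enorm_sub_sq_le z.1 z.2).trans (le_of_eq ?_)
  rw [lintegral_add_left (by fun_prop), lintegral_const_mul _ (by fun_prop),
    lintegral_const_mul _ (by fun_prop),
    lintegral_fst_normalizedProd h (f := fun x => ‖x‖ₑ ^ 2) (by fun_prop),
    lintegral_snd_normalizedProd h (f := fun x => ‖x‖ₑ ^ 2) (by fun_prop)]

lemma lintegral_normalizedProd_le_of_ae {α β : Measure (EuclideanSpace ℝ (Fin d))}
    [IsFiniteMeasure α] [IsFiniteMeasure β] (h : α Set.univ = β Set.univ)
    {y : EuclideanSpace ℝ (Fin d)} {e : ℝ≥0∞} (hα : ∀ᵐ x ∂α, ‖x - y‖ₑ ≤ e)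
    (hβ : ∀ᵐ x ∂β, ‖x - y‖ₑ ≤ e) :
    ∫⁻ z, ‖z.1 - z.2‖ₑ ^ 2 ∂(normalizedProd α β) ≤ 4 * e ^ 2 * α Set.univ := by
  have h1 : ∀ᵐ z ∂(normalizedProd α β), ‖z.1 - y‖ₑ ≤ e := by
    rw [← map_fst_normalizedProd h] at hα
    exact ae_of_ae_map measurable_fst.aemeasurable hα
  have h2 : ∀ᵐ z ∂(normalizedProd α β), ‖z.2 - y‖ₑ ≤ e := by
    rw [← map_snd_normalizedProd h] at hβ
    exact ae_of_ae_map measurable_snd.aemeasurable hβ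
  have h3 : ∀ᵐ z ∂(normalizedProd α β), ‖z.1 - z.2‖ₑ ^ 2 ≤ 4 * e ^ 2 := by
    filter_upwards [h1, h2] with z hz1 hz2
    have h5 : ‖z.1 - z.2‖ₑ ≤ 2 * e := by
      rw [← sub_sub_sub_cancel_right z.1 z.2 y, two_mul]
      exact (enorm_sub_le).trans (add_le_add hz1 hz2)
    refine (pow_le_pow_left₀ zero_le h5 2).trans (le_of_eq ?_)
    rw [mul_pow]; norm_num
  refine (lintegral_mono_ae h3).trans (le_of_eq ?_)
  rw [lintegral_const]
  congr 1
  have := lintegral_fst_normalizedProd h (f := fun _ => 1) measurable_const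
  simpa using this

/-- Two measures that assign similar masses to the pieces of a fine soft partition are close in
the Wasserstein distance. -/
theorem wasserstein_two_sq_le_of_partition
    (μ ν : ProbabilityMeasure (EuclideanSpace ℝ (Fin d))) {ι : Type*} (s : Finset ι)
    {ψ : ι → EuclideanSpace ℝ (Fin d) → ℝ≥0∞} (hψ : ∀ k, Measurable (ψ k))
    (hsum : ∀ x, ∑ k ∈ s, ψ k x ≤ 1) {y : ι → EuclideanSpace ℝ (Fin d)} {e : ℝ≥0∞}
    (hsupp : ∀ k x, ψ k x ≠ 0 → ‖x - y k‖ₑ ≤ e) (R : ℝ) :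
    wasserstein 2 μ ν ^ 2 ≤ 4 * e ^ 2 +
      16 * ENNReal.ofReal R ^ 2 *
        (1 - ∑ k ∈ s, min (∫⁻ x, ψ k x ∂(μ : Measure (EuclideanSpace ℝ (Fin d))))
          (∫⁻ x, ψ k x ∂(ν : Measure (EuclideanSpace ℝ (Fin d))))) +
      8 * (tailMoment R (μ : Measure (EuclideanSpace ℝ (Fin d))) +
        tailMoment R (ν : Measure (EuclideanSpace ℝ (Fin d)))) := by
  -- `c k` is the largest mass that both measures can spend on piece `k`.
  set c : ι → ℝ≥0∞ := fun k => min (∫⁻ x, ψ k x ∂(μ : Measure (EuclideanSpace ℝ (Fin d))))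
    (∫⁻ x, ψ k x ∂(ν : Measure (EuclideanSpace ℝ (Fin d)))) with hc
  obtain ⟨α, r, hαr, hr, hα⟩ := exists_split (μ : Measure (EuclideanSpace ℝ (Fin d))) s hψ hsum
    (c := c) (fun k _ => min_le_left _ _)
  obtain ⟨β, q, hβq, hq, hβ⟩ := exists_split (ν : Measure (EuclideanSpace ℝ (Fin d))) s hψ hsum
    (c := c) (fun k _ => min_le_right _ _)
  have hmr : ∑ k ∈ s, c k + r Set.univ = 1 := by
    rw [← measure_univ (μ := (μ : Measure (EuclideanSpace ℝ (Fin d)))), ← hαr,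
      Measure.add_apply, Measure.finsetSum_apply, Finset.sum_congr rfl fun k hk => (hα k hk).2.1]
  have hmq : ∑ k ∈ s, c k + q Set.univ = 1 := by
    rw [← measure_univ (μ := (ν : Measure (EuclideanSpace ℝ (Fin d)))), ← hβq,
      Measure.add_apply, Measure.finsetSum_apply, Finset.sum_congr rfl fun k hk => (hβ k hk).2.1]
  have hctop : ∑ k ∈ s, c k ≠ ∞ := ne_top_of_le_ne_top ENNReal.one_ne_top (le_self_add.trans hmr.le)
  have hr1 : r Set.univ = 1 - ∑ k ∈ s, c k :=
    ENNReal.eq_sub_of_add_eq hctop (by rw [add_comm, hmr])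
  have hq1 : q Set.univ = 1 - ∑ k ∈ s, c k :=
    ENNReal.eq_sub_of_add_eq hctop (by rw [add_comm, hmq])
  have hrq : r Set.univ = q Set.univ := hr1.trans hq1.symm
  -- Matched pieces are coupled within a ball of radius `e`, at cost at most `4 * e ^ 2` per unit
  -- mass. The remainders are coupled independently, their cost being bounded by their mass times `R
  -- ^ 2` plus tails.
  set Γ : Measure (EuclideanSpace ℝ (Fin d) × EuclideanSpace ℝ (Fin d)) :=
    ∑ k ∈ s, normalizedProd (α k) (β k) + normalizedProd r q with hΓ
  have hfst : Γ.map Prod.fst = μ := by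
    rw [hΓ, Measure.map_add _ _ measurable_fst,
      Measure.map_finset_sum measurable_fst.aemeasurable, map_fst_normalizedProd hrq]
    conv_rhs => rw [← hαr]
    congr 1
    refine Finset.sum_congr rfl fun k hk => ?_
    have := (hα k hk).1
    have := (hβ k hk).1
    exact map_fst_normalizedProd ((hα k hk).2.1.trans (hβ k hk).2.1.symm)
  have hsnd : Γ.map Prod.snd = ν := by
    rw [hΓ, Measure.map_add _ _ measurable_snd,
      Measure.map_finset_sum measurable_snd.aemeasurable, map_snd_normalizedProd hrq]
    conv_rhs => rw [← hβq]
    congr 1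
    refine Finset.sum_congr rfl fun k hk => ?_
    have := (hα k hk).1
    have := (hβ k hk).1
    exact map_snd_normalizedProd ((hα k hk).2.1.trans (hβ k hk).2.1.symm)
  have hprob : IsProbabilityMeasure Γ := by
    constructor
    have h := congrArg (fun m => m Set.univ) hfst
    simpa [Measure.map_apply measurable_fst MeasurableSet.univ] using h
  refine (wasserstein_two_sq_le_of_map (P := Γ) measurable_fst measurable_snd hfst hsnd).trans ?_
  rw [hΓ, lintegral_add_measure, lintegral_finsetSum_measure, add_assoc]
  refine add_le_add ?_ ?_
  · calc ∑ k ∈ s, ∫⁻ z, ‖z.1 - z.2‖ₑ ^ 2 ∂(normalizedProd (α k) (β k))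
        ≤ ∑ k ∈ s, 4 * e ^ 2 * c k := by
          refine Finset.sum_le_sum fun k hk => ?_
          obtain ⟨_, hαk, hαs⟩ := hα k hk
          obtain ⟨_, hβk, hβs⟩ := hβ k hk
          rw [← hαk]
          exact lintegral_normalizedProd_le_of_ae (hαk.trans hβk.symm)
            (hαs.mono (hsupp k)) (hβs.mono (hsupp k))
      _ = 4 * e ^ 2 * ∑ k ∈ s, c k := by rw [Finset.mul_sum]
      _ ≤ 4 * e ^ 2 := mul_le_of_le_one_right zero_le (le_self_add.trans hmr.le)
  · have hrμ : r ≤ μ := by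
      rw [← hαr]; exact Measure.le_add_left le_rfl
    have hqν : q ≤ ν := by
      rw [← hβq]; exact Measure.le_add_left le_rfl
    have h1 := (lintegral_enorm_sq_le_tailMoment R r).trans
      (add_le_add_right (mul_le_mul_right (tailMoment_mono (R := R) hrμ) 4) _)
    have h2 := (lintegral_enorm_sq_le_tailMoment R q).trans
      (add_le_add_right (mul_le_mul_right (tailMoment_mono (R := R) hqν) 4) _)
    rw [hr1] at h1
    rw [hq1] at h2
    refine (lintegral_normalizedProd_le hrq).trans
      ((add_le_add (mul_le_mul_right h1 2) (mul_le_mul_right h2 2)).trans (le_of_eq ?_))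
    ring

/-- Uniform integrability of second moments together with asymptotic agreement on fine soft
partitions gives convergence in the Wasserstein distance. -/
theorem tendsto_wasserstein_two_of_partition
    {μ ν : ℕ → ProbabilityMeasure (EuclideanSpace ℝ (Fin d))}
    (htail : ∀ η : ℝ≥0∞, 0 < η → ∃ R : ℝ, ∀ t,
      tailMoment R (μ t : Measure (EuclideanSpace ℝ (Fin d))) ≤ η ∧
      tailMoment R (ν t : Measure (EuclideanSpace ℝ (Fin d))) ≤ η)
    (hpart : ∀ e η : ℝ≥0∞, 0 < e → 0 < η → ∃ (N : ℕ)
      (ψ : ℕ → EuclideanSpace ℝ (Fin d) → ℝ≥0∞) (y : ℕ → EuclideanSpace ℝ (Fin d))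
      (b : ℕ → ℝ≥0∞), (∀ k, Measurable (ψ k)) ∧ (∀ x, ∑ k ∈ Finset.range N, ψ k x ≤ 1) ∧
      (∀ k x, ψ k x ≠ 0 → ‖x - y k‖ₑ ≤ e) ∧
      (∀ k, Tendsto (fun t => ∫⁻ x, ψ k x ∂(μ t : Measure (EuclideanSpace ℝ (Fin d))))
        atTop (𝓝 (b k))) ∧
      (∀ k, Tendsto (fun t => ∫⁻ x, ψ k x ∂(ν t : Measure (EuclideanSpace ℝ (Fin d))))
        atTop (𝓝 (b k))) ∧ 1 - ∑ k ∈ Finset.range N, b k < η) :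
    Tendsto (fun t => wasserstein 2 (μ t) (ν t)) atTop (𝓝 0) := by
  have hsq : Tendsto (fun t => wasserstein 2 (μ t) (ν t) ^ 2) atTop (𝓝 0) := by
    rw [ENNReal.tendsto_nhds_zero]
    intro ε hε
    -- Budget of four parts `θ`: one for the diameter term, one for the unmatched mass, two for the
    -- tails.
    obtain ⟨θ, hθ0, hθε⟩ : ∃ θ : NNReal, 0 < θ ∧ 4 * (θ : ℝ≥0∞) < ε := by
      have h : Tendsto (fun x : ℝ≥0∞ => 4 * x) (𝓝 0) (𝓝 (4 * 0)) :=
        ENNReal.Tendsto.const_mul tendsto_id (by simp)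
      rw [mul_zero] at h
      obtain ⟨u, hu0, hu⟩ := ENNReal.nhds_zero_basis.mem_iff.1 (h (Iio_mem_nhds hε))
      obtain ⟨θ, hθ1, hθ2⟩ := ENNReal.lt_iff_exists_nnreal_btwn.1 hu0
      exact ⟨θ, by simpa using hθ1, hu hθ2⟩
    have hθ : (0 : ℝ≥0∞) < θ := by simpa using hθ0
    obtain ⟨e, he0, he⟩ : ∃ e : ℝ≥0∞, 0 < e ∧ 4 * e ^ 2 ≤ θ := by
      refine ⟨((NNReal.sqrt θ / 2 : NNReal) : ℝ≥0∞), ?_, ?_⟩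
      · have : 0 < NNReal.sqrt θ / 2 := by positivity
        exact_mod_cast this
      · have : 4 * (NNReal.sqrt θ / 2) ^ 2 = θ := by
          rw [div_pow, NNReal.sq_sqrt]; norm_num; field_simp
        exact_mod_cast this.le
    obtain ⟨R, htR⟩ := htail (θ / 8) (by simpa using hθ0.ne')
    set C : ℝ≥0∞ := 16 * ENNReal.ofReal R ^ 2 with hC
    have hCtop : C ≠ ∞ := by finiteness
    -- Dividing by `C + 1` rather than `C` covers the case `C = 0`.
    obtain ⟨N, ψ, y, b, hψ, hsum, hsupp, hμb, hνb, hb⟩ := hpart e (θ / (C + 1)) he0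
      (ENNReal.div_pos hθ.ne' (by finiteness))
    have hlim : Tendsto (fun t => C * (1 - ∑ k ∈ Finset.range N,
        min (∫⁻ x, ψ k x ∂(μ t : Measure (EuclideanSpace ℝ (Fin d))))
          (∫⁻ x, ψ k x ∂(ν t : Measure (EuclideanSpace ℝ (Fin d))))))
        atTop (𝓝 (C * (1 - ∑ k ∈ Finset.range N, b k))) := by
      refine ENNReal.Tendsto.const_mul ?_ (Or.inr hCtop)
      refine ENNReal.Tendsto.sub tendsto_const_nhds ?_ (Or.inl ENNReal.one_ne_top)
      refine tendsto_finsetSum _ fun k _ => ?_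
      simpa using (hμb k).min (hνb k)
    have hlt : C * (1 - ∑ k ∈ Finset.range N, b k) < θ := by
      have h1 : (C + 1) * (1 - ∑ k ∈ Finset.range N, b k) < θ := by
        rw [mul_comm]
        exact ENNReal.mul_lt_of_lt_div hb
      exact (mul_le_mul_left le_self_add _).trans_lt h1
    filter_upwards [hlim.eventually_lt_const hlt] with t ht
    refine (wasserstein_two_sq_le_of_partition (μ t) (ν t) (Finset.range N) hψ hsum hsupp
      R).trans ?_
    have h8 : 8 * (tailMoment R (μ t : Measure (EuclideanSpace ℝ (Fin d))) +
        tailMoment R (ν t : Measure (EuclideanSpace ℝ (Fin d)))) ≤ θ + θ := by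
      have h81 : 8 * ((θ : ℝ≥0∞) / 8) = θ := ENNReal.mul_div_cancel (by simp) (by simp)
      calc _ ≤ 8 * ((θ : ℝ≥0∞) / 8 + (θ : ℝ≥0∞) / 8) :=
            mul_le_mul_right (add_le_add (htR t).1 (htR t).2) _
        _ = _ := by rw [mul_add, h81]
    refine (add_le_add (add_le_add he ht.le) h8).trans (le_trans (le_of_eq ?_) hθε.le)
    ring
  have h := hsq.ennrpow_const (1 / 2)
  simp_rw [← ENNReal.rpow_two, ← ENNReal.rpow_mul] at h
  simpa using h

end Coupling

/-! ### Differences of Lipschitz convex functions -/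

section DiffConvex

variable {E : Type*} [NormedAddCommGroup E] [NormedSpace ℝ E]

/-- Nonnegative Lipschitz convex functions. -/
def IsLipschitzConvex (u : E → ℝ) : Prop :=
  (∀ x, 0 ≤ u x) ∧ ConvexOn ℝ Set.univ u ∧ ∃ K, LipschitzWith K u

/-- Differences of nonnegative Lipschitz convex functions. -/
def IsDiffLipschitzConvex (f : E → ℝ) : Prop :=
  ∃ u v, IsLipschitzConvex u ∧ IsLipschitzConvex v ∧ ∀ x, f x = u x - v x

lemma IsLipschitzConvex.add {u v : E → ℝ} (hu : IsLipschitzConvex u) (hv : IsLipschitzConvex v) :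
    IsLipschitzConvex fun x => u x + v x := by
  obtain ⟨hu0, huc, K, hK⟩ := hu
  obtain ⟨hv0, hvc, K', hK'⟩ := hv
  exact ⟨fun x => add_nonneg (hu0 x) (hv0 x), huc.add hvc, _, hK.add hK'⟩

lemma IsLipschitzConvex.max {u v : E → ℝ} (hu : IsLipschitzConvex u) (hv : IsLipschitzConvex v) :
    IsLipschitzConvex fun x => max (u x) (v x) := by
  obtain ⟨hu0, huc, K, hK⟩ := hu
  obtain ⟨hv0, hvc, K', hK'⟩ := hv
  exact ⟨fun x => le_max_of_le_left (hu0 x), huc.sup hvc, _, hK.max hK'⟩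

lemma isLipschitzConvex_const {r : ℝ} (hr : 0 ≤ r) : IsLipschitzConvex fun _ : E => r :=
  ⟨fun _ => hr, convexOn_const _ convex_univ, 0, LipschitzWith.const r⟩

lemma isLipschitzConvex_mul_dist {c : ℝ} (hc : 0 ≤ c) (y : E) :
    IsLipschitzConvex fun x => c * dist x y := by
  refine ⟨fun x => by positivity, (convexOn_univ_dist y).smul hc, c.toNNReal * 1,
    LipschitzWith.of_dist_le_mul fun x z => ?_⟩
  rw [Real.dist_eq, ← mul_sub, abs_mul, abs_of_nonneg hc, mul_one, Real.coe_toNNReal _ hc]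
  exact mul_le_mul_of_nonneg_left (abs_dist_sub_le x z y) hc

lemma IsLipschitzConvex.isDiff {u : E → ℝ} (hu : IsLipschitzConvex u) :
    IsDiffLipschitzConvex u :=
  ⟨u, fun _ => 0, hu, isLipschitzConvex_const le_rfl, fun _ => (sub_zero _).symm⟩

lemma IsDiffLipschitzConvex.sub {f g : E → ℝ} (hf : IsDiffLipschitzConvex f)
    (hg : IsDiffLipschitzConvex g) : IsDiffLipschitzConvex fun x => f x - g x := by
  obtain ⟨u, v, hu, hv, h⟩ := hf
  obtain ⟨u', v', hu', hv', h'⟩ := hg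
  exact ⟨_, _, hu.add hv', hv.add hu', fun x => by simp only [h, h']; ring⟩

/-- Adding `v + v'` to both entries gives `max (u - v) (u' - v') = max (u + v') (u' + v) - (v +
v')`. -/
lemma IsDiffLipschitzConvex.max {f g : E → ℝ} (hf : IsDiffLipschitzConvex f)
    (hg : IsDiffLipschitzConvex g) : IsDiffLipschitzConvex fun x => max (f x) (g x) := by
  obtain ⟨u, v, hu, hv, h⟩ := hf
  obtain ⟨u', v', hu', hv', h'⟩ := hg
  refine ⟨_, _, (hu.add hv').max (hu'.add hv), hv.add hv', fun x => ?_⟩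
  simp only [h, h', ← max_sub_sub_right]
  congr 1 <;> ring

lemma IsDiffLipschitzConvex.continuous {f : E → ℝ} (hf : IsDiffLipschitzConvex f) :
    Continuous f := by
  obtain ⟨u, v, ⟨-, -, K, hu⟩, ⟨-, -, K', hv⟩, h⟩ := hf
  rw [funext h]
  exact hu.continuous.sub hv.continuous

end DiffConvex

/-! ### A soft partition made of differences of convex functions -/

section SoftCover

variable {E : Type*} [NormedAddCommGroup E]

/-- A bump function equal to `1` near `y` and vanishing at distance `ε` from `y`. -/
noncomputable def bump (ε : ℝ) (y x : E) : ℝ :=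
  max (2 / ε * dist x y) 2 - max (2 / ε * dist x y) 1

lemma bump_le_one (ε : ℝ) (y x : E) : bump ε y x ≤ 1 := by
  rw [bump, sub_le_iff_le_add]
  exact max_le (by linarith [le_max_left (2 / ε * dist x y) 1])
    (by linarith [le_max_right (2 / ε * dist x y) 1])

lemma bump_eq_one {ε : ℝ} (hε : 0 < ε) {y x : E} (h : dist x y ≤ ε / 2) : bump ε y x = 1 := by
  have h1 : 2 / ε * dist x y ≤ 1 := by
    rw [div_mul_eq_mul_div, div_le_one hε]; linarith
  rw [bump, max_eq_right h1, max_eq_right (by linarith)]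
  norm_num

lemma dist_le_of_bump_ne_zero {ε : ℝ} (hε : 0 < ε) {y x : E} (h : bump ε y x ≠ 0) :
    dist x y ≤ ε := by
  by_contra! hlt
  have h1 : 2 ≤ 2 / ε * dist x y := by
    rw [div_mul_eq_mul_div, le_div_iff₀ hε]; linarith
  refine h ?_
  rw [bump, max_eq_left h1, max_eq_left (by linarith), sub_self]

/-- The maximum of the bump functions at the first `k` points of a sequence. -/
noncomputable def bumpMax (ε : ℝ) (y : ℕ → E) : ℕ → E → ℝ
  | 0, _ => 0
  | k + 1, x => max (bumpMax ε y k x) (bump ε (y k) x)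

lemma bumpMax_mono (ε : ℝ) (y : ℕ → E) (x : E) : Monotone fun k => bumpMax ε y k x :=
  monotone_nat_of_le_succ fun _ => le_max_left _ _

lemma bumpMax_nonneg (ε : ℝ) (y : ℕ → E) (k : ℕ) (x : E) : 0 ≤ bumpMax ε y k x :=
  bumpMax_mono ε y x (Nat.zero_le k)

lemma bumpMax_le_one (ε : ℝ) (y : ℕ → E) (k : ℕ) (x : E) : bumpMax ε y k x ≤ 1 := by
  induction k with
  | zero => exact zero_le_one
  | succ k ih => exact max_le ih (bump_le_one _ _ _)

lemma isDiffLipschitzConvex_bump [NormedSpace ℝ E] {ε : ℝ} (hε : 0 < ε) (y : E) :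
    IsDiffLipschitzConvex (bump ε y) :=
  ⟨_, _, (isLipschitzConvex_mul_dist (by positivity) y).max (isLipschitzConvex_const zero_le_two),
    (isLipschitzConvex_mul_dist (by positivity) y).max (isLipschitzConvex_const zero_le_one),
    fun _ => rfl⟩

lemma isDiffLipschitzConvex_bumpMax [NormedSpace ℝ E] {ε : ℝ} (hε : 0 < ε) (y : ℕ → E)
    (k : ℕ) : IsDiffLipschitzConvex (bumpMax ε y k) := by
  induction k with
  | zero => exact (isLipschitzConvex_const le_rfl).isDiff
  | succ k ih => exact ih.max (isDiffLipschitzConvex_bump hε (y k))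

/-- The pieces of the soft partition obtained from the bump functions. -/
noncomputable def softPiece (ε : ℝ) (y : ℕ → E) (k : ℕ) (x : E) : ℝ :=
  bumpMax ε y (k + 1) x - bumpMax ε y k x

lemma softPiece_nonneg (ε : ℝ) (y : ℕ → E) (k : ℕ) (x : E) : 0 ≤ softPiece ε y k x :=
  sub_nonneg.2 (bumpMax_mono ε y x (Nat.le_succ k))

/-- The pieces are increments of the running maximum, so their sum telescopes. -/
lemma sum_ofReal_softPiece (ε : ℝ) (y : ℕ → E) (N : ℕ) (x : E) :
    ∑ k ∈ Finset.range N, ENNReal.ofReal (softPiece ε y k x)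
      = ENNReal.ofReal (bumpMax ε y N x) := by
  rw [← ENNReal.ofReal_sum_of_nonneg fun k _ => softPiece_nonneg ε y k x]
  simp only [softPiece]
  rw [Finset.sum_range_sub (fun k => bumpMax ε y k x)]
  simp [bumpMax]

lemma dist_le_of_softPiece_ne_zero {ε : ℝ} (hε : 0 < ε) {y : ℕ → E} {k : ℕ} {x : E}
    (h : softPiece ε y k x ≠ 0) : dist x (y k) ≤ ε := by
  refine dist_le_of_bump_ne_zero hε fun h0 => h ?_
  rw [softPiece, bumpMax, h0, max_eq_left (bumpMax_nonneg ε y k x), sub_self]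

lemma tendsto_bumpMax {ε : ℝ} (hε : 0 < ε) {y : ℕ → E} (hy : DenseRange y) (x : E) :
    Tendsto (fun N => bumpMax ε y N x) atTop (𝓝 1) := by
  obtain ⟨j, hj⟩ := hy.exists_dist_lt x (half_pos hε)
  refine tendsto_const_nhds.congr' ?_
  filter_upwards [eventually_ge_atTop (j + 1)] with N hN
  refine le_antisymm ?_ (bumpMax_le_one ε y N x)
  refine le_trans ?_ (bumpMax_mono ε y x hN)
  exact (bump_eq_one hε hj.le).symm.le.trans (le_max_right _ _)

lemma tendsto_lintegral_bumpMax [MeasurableSpace E] [BorelSpace E] [NormedSpace ℝ E] {ε : ℝ}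
    (hε : 0 < ε) {y : ℕ → E} (hy : DenseRange y) (μ : Measure E) [IsProbabilityMeasure μ] :
    Tendsto (fun N => ∫⁻ x, ENNReal.ofReal (bumpMax ε y N x) ∂μ) atTop (𝓝 1) := by
  have h := lintegral_tendsto_of_tendsto_of_monotone (μ := μ)
    (f := fun N x => ENNReal.ofReal (bumpMax ε y N x)) (F := fun _ => 1)
    (fun N => ((isDiffLipschitzConvex_bumpMax hε y N).continuous.measurable.ennreal_ofReal
      ).aemeasurable)
    (Eventually.of_forall fun x => ENNReal.ofReal_mono.comp (bumpMax_mono ε y x))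
    (Eventually.of_forall fun x => by
      simpa using ENNReal.tendsto_ofReal (tendsto_bumpMax hε hy x))
  simpa using h

end SoftCover

/-! ### Convergence of integrals of test functions -/

section TestFunctions

variable {d : ℕ}

lemma IsLipschitzConvex.lintegral_ne_top {u : EuclideanSpace ℝ (Fin d) → ℝ}
    (hu : IsLipschitzConvex u) {μ : ProbabilityMeasure (EuclideanSpace ℝ (Fin d))}
    (hμ : μ ∈ PSpace d 2) :
    ∫⁻ x, ENNReal.ofReal (u x) ∂(μ : Measure (EuclideanSpace ℝ (Fin d))) ≠ ∞ := by
  obtain ⟨-, -, K, hK⟩ := hu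
  rw [mem_PSpace_two] at hμ
  have h : ∀ x, ENNReal.ofReal (u x) ≤ ENNReal.ofReal (u 0 + K) + K * ‖x‖ₑ ^ 2 := by
    intro x
    have h1 := hK.dist_le_mul x 0
    rw [Real.dist_eq, dist_zero_right] at h1
    have h2 : u x ≤ (u 0 + K) + K * ‖x‖ ^ 2 := by
      have h3 : ‖x‖ ≤ 1 + ‖x‖ ^ 2 := by nlinarith [sq_nonneg (‖x‖ - 1), norm_nonneg x]
      have h4 := mul_le_mul_of_nonneg_left h3 K.coe_nonneg
      linarith [le_abs_self (u x - u 0)]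
    refine (ENNReal.ofReal_le_ofReal h2).trans (ENNReal.ofReal_add_le.trans ?_)
    rw [ENNReal.ofReal_mul K.coe_nonneg, ENNReal.ofReal_pow (norm_nonneg _), ofReal_norm,
      ENNReal.ofReal_coe_nnreal]
  refine ne_top_of_le_ne_top ?_ (lintegral_mono h)
  rw [lintegral_add_left (by fun_prop), lintegral_const, lintegral_const_mul _ (by fun_prop)]
  have := hμ.ne
  finiteness

/-- Finite limits for the two convex parts can be subtracted; since `f` is nonnegative, truncated
subtraction loses nothing. -/
lemma IsDiffLipschitzConvex.exists_tendsto_lintegral {ι : Type*}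
    {μ : ι → ℕ → ProbabilityMeasure (EuclideanSpace ℝ (Fin d))}
    (hμ : ∀ i t, μ i t ∈ PSpace d 2)
    (hconv : ∀ u, IsLipschitzConvex u → ∃ M : ℝ≥0∞, M ≠ ∞ ∧ ∀ i, Tendsto (fun t =>
      ∫⁻ x, ENNReal.ofReal (u x) ∂(μ i t : Measure (EuclideanSpace ℝ (Fin d)))) atTop (𝓝 M))
    {f : EuclideanSpace ℝ (Fin d) → ℝ} (hf : IsDiffLipschitzConvex f) (hf0 : ∀ x, 0 ≤ f x) :
    ∃ M : ℝ≥0∞, ∀ i, Tendsto (fun t =>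
      ∫⁻ x, ENNReal.ofReal (f x) ∂(μ i t : Measure (EuclideanSpace ℝ (Fin d)))) atTop
      (𝓝 M) := by
  obtain ⟨u, v, hu, hv, h⟩ := hf
  obtain ⟨M, hM, huM⟩ := hconv u hu
  obtain ⟨M', -, hvM⟩ := hconv v hv
  refine ⟨M - M', fun i => ?_⟩
  refine (ENNReal.Tendsto.sub (huM i) (hvM i) (Or.inl hM)).congr fun t => ?_
  obtain ⟨hv0, -, K, hK⟩ := id hv
  have hvm : Measurable v := hK.continuous.measurable
  rw [← lintegral_sub (by fun_prop) (hv.lintegral_ne_top (hμ i t))]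
  · refine lintegral_congr fun x => ?_
    rw [h, ENNReal.ofReal_sub _ (hv0 x)]
  · refine Eventually.of_forall fun x => ENNReal.ofReal_le_ofReal ?_
    linarith [hf0 x, h x]

lemma tendsto_lintegral_ofReal_of_bounded {X ι : Type*} [MeasurableSpace X] [TopologicalSpace X]
    [OpensMeasurableSpace X] {l : Filter ι} {μ : ι → ProbabilityMeasure X}
    {ν : ProbabilityMeasure X} (h : Tendsto μ l (𝓝 ν)) {f : X → ℝ} (hf : Continuous f)
    (hf0 : ∀ x, 0 ≤ f x) {C : ℝ} (hfC : ∀ x, f x ≤ C) :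
    Tendsto (fun t => ∫⁻ x, ENNReal.ofReal (f x) ∂(μ t : Measure X)) l
      (𝓝 (∫⁻ x, ENNReal.ofReal (f x) ∂(ν : Measure X))) := by
  let g : BoundedContinuousFunction X NNReal :=
    BoundedContinuousFunction.mkOfBound ⟨fun x => (f x).toNNReal, by fun_prop⟩ C fun x y => by
      simp only [ContinuousMap.coe_mk, NNReal.dist_eq, Real.coe_toNNReal _ (hf0 _)]
      rw [abs_le]
      constructor <;> linarith [hf0 x, hf0 y, hfC x, hfC y]
  exact ProbabilityMeasure.tendsto_iff_forall_lintegral_tendsto.1 h g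

end TestFunctions

/-! ### Uniform integrability, tightness and the limit measure -/

section TailMoments

variable {d : ℕ}

/-- The square of this function integrates to `tailMoment R`, so Jensen's inequality with exponent
`2` propagates tail bounds in time. -/
lemma isLipschitzConvex_norm_sub (R : ℝ) :
    IsLipschitzConvex fun x : EuclideanSpace ℝ (Fin d) => max (‖x‖ - R) 0 := by
  refine ⟨fun x => le_max_right _ _, ?_, max 1 0, ?_⟩
  · exact ((convexOn_univ_norm.sub (concaveOn_const R convex_univ))).sup
      (convexOn_const 0 convex_univ)
  · refine LipschitzWith.max ?_ (LipschitzWith.const 0)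
    exact LipschitzWith.of_dist_le_mul fun x y => by
      simpa [Real.dist_eq, dist_eq_norm] using abs_norm_sub_norm_le x y

lemma tailMoment_eq (R : ℝ) (μ : Measure (EuclideanSpace ℝ (Fin d))) :
    tailMoment R μ = ∫⁻ x, ENNReal.ofReal (max (‖x‖ - R) 0) ^ (2 : ℝ) ∂μ := by
  refine lintegral_congr fun x => ?_
  rw [ENNReal.rpow_two, ENNReal.ofReal_max, ENNReal.ofReal_zero, max_eq_left zero_le]

lemma tendsto_tailMoment {μ : ProbabilityMeasure (EuclideanSpace ℝ (Fin d))}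
    (hμ : μ ∈ PSpace d 2) :
    Tendsto (fun R : ℕ => tailMoment R (μ : Measure (EuclideanSpace ℝ (Fin d)))) atTop
      (𝓝 0) := by
  rw [mem_PSpace_two] at hμ
  have h := tendsto_lintegral_of_dominated_convergence
    (μ := (μ : Measure (EuclideanSpace ℝ (Fin d))))
    (F := fun (R : ℕ) x => ENNReal.ofReal (‖x‖ - R) ^ 2) (f := fun _ => 0)
    (fun x => ‖x‖ₑ ^ 2) (fun R => by fun_prop)
    (fun R => Eventually.of_forall fun x => ?_) hμ.ne
    (Eventually.of_forall fun x => ?_)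
  · simpa [tailMoment] using h
  · simp only [← ofReal_norm]
    exact pow_le_pow_left₀ zero_le (ENNReal.ofReal_le_ofReal (by
      have : (0 : ℝ) ≤ R := by positivity
      linarith)) 2
  · obtain ⟨N, hN⟩ := exists_nat_ge ‖x‖
    refine tendsto_const_nhds.congr' ?_
    filter_upwards [eventually_ge_atTop N] with R hR
    have : (N : ℝ) ≤ R := by exact_mod_cast hR
    rw [ENNReal.ofReal_of_nonpos (by linarith)]
    simp

lemma measure_compl_closedBall_le_tailMoment (R : ℝ)
    (μ : Measure (EuclideanSpace ℝ (Fin d))) :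
    μ (Metric.closedBall 0 (R + 1))ᶜ ≤ tailMoment R μ := by
  rw [← lintegral_indicator_one Metric.isClosed_closedBall.measurableSet.compl]
  refine lintegral_mono fun x => ?_
  by_cases hx : x ∈ (Metric.closedBall (0 : EuclideanSpace ℝ (Fin d)) (R + 1))ᶜ
  · rw [Set.indicator_of_mem hx]
    simp only [Set.mem_compl_iff, mem_closedBall_zero_iff, not_le] at hx
    exact one_le_pow₀ (ENNReal.one_le_ofReal.2 (by linarith))
  · rw [Set.indicator_of_notMem hx]
    exact zero_le

lemma wasserstein_le_wasserstein_two {p : ℝ} (hp0 : 0 < p) (hp : p ≤ 2)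
    (μ ν : ProbabilityMeasure (EuclideanSpace ℝ (Fin d))) :
    wasserstein p μ ν ≤ wasserstein 2 μ ν := by
  refine iInf₂_mono fun γ _ => ?_
  have h := eLpNorm'_le_eLpNorm'_of_exponent_le
    (f := fun z : EuclideanSpace ℝ (Fin d) × EuclideanSpace ℝ (Fin d) => z.1 - z.2) hp0 hp
    (γ : Measure (EuclideanSpace ℝ (Fin d) × EuclideanSpace ℝ (Fin d))) (by fun_prop)
  exact h

/-- Sequences of measures with uniformly integrable second moments along which the integrals of
all Lipschitz convex functions converge to a common limit converge to a common measure. -/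
theorem exists_tendsto_wasserstein_of_convex {ι : Type*} [Nonempty ι]
    {μ : ι → ℕ → ProbabilityMeasure (EuclideanSpace ℝ (Fin d))}
    (hμ : ∀ i t, μ i t ∈ PSpace d 2)
    (htail : ∀ η : ℝ≥0∞, 0 < η → ∃ R : ℝ, ∀ i t,
      tailMoment R (μ i t : Measure (EuclideanSpace ℝ (Fin d))) ≤ η)
    (hconv : ∀ u, IsLipschitzConvex u → ∃ M : ℝ≥0∞, M ≠ ∞ ∧ ∀ i, Tendsto (fun t =>
      ∫⁻ x, ENNReal.ofReal (u x) ∂(μ i t : Measure (EuclideanSpace ℝ (Fin d)))) atTop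
      (𝓝 M)) :
    (∀ i j, Tendsto (fun t => wasserstein 2 (μ i t) (μ j t)) atTop (𝓝 0)) ∧
    ∃ ν ∈ PSpace d 2, ∀ i, Tendsto (fun t => wasserstein 2 (μ i t) ν) atTop (𝓝 0) := by
  obtain ⟨i₀⟩ := ‹Nonempty ι›
  have htight : IsTightMeasureSet {x | ∃ m ∈ Set.range (μ i₀),
      (m : Measure (EuclideanSpace ℝ (Fin d))) = x} := by
    rw [isTightMeasureSet_iff_exists_isCompact_measure_compl_le]
    intro ε hε
    obtain ⟨R, hR⟩ := htail ε hε
    refine ⟨Metric.closedBall 0 (R + 1), isCompact_closedBall _ _, ?_⟩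
    rintro _ ⟨_, ⟨t, rfl⟩, rfl⟩
    exact (measure_compl_closedBall_le_tailMoment R _).trans (hR i₀ t)
  -- Prokhorov's theorem is applied to a single agent; the subsequence serves only to identify the
  -- limits.
  obtain ⟨ν, -, φ, hφ, hν⟩ := (isCompact_closure_of_isTightMeasureSet htight).tendsto_subseq
    (x := μ i₀) fun t => subset_closure (Set.mem_range_self t)
  -- Tail moments are lower semicontinuous under weak convergence, so uniform bounds pass to `ν`.
  have hνtail : ∀ (R : ℝ) (η : ℝ≥0∞), (∀ i t, tailMoment R
      (μ i t : Measure (EuclideanSpace ℝ (Fin d))) ≤ η) →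
      tailMoment R (ν : Measure (EuclideanSpace ℝ (Fin d))) ≤ η := by
    intro R η h
    have h1 := lintegral_le_liminf_lintegral_of_forall_isOpen_measure_le_liminf_measure
      (μ := (ν : Measure (EuclideanSpace ℝ (Fin d))))
      (μs := fun t => (μ i₀ (φ t) : Measure (EuclideanSpace ℝ (Fin d))))
      (f := fun x => max (‖x‖ - R) 0 ^ 2) (by fun_prop) (fun x => by positivity)
      (fun G hG => ProbabilityMeasure.le_liminf_measure_open_of_tendsto hν hG)
    have h2 : ∀ m : Measure (EuclideanSpace ℝ (Fin d)),
        ∫⁻ x, ENNReal.ofReal (max (‖x‖ - R) 0 ^ 2) ∂m = tailMoment R m := by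
      intro m
      rw [tailMoment_eq]
      refine lintegral_congr fun x => ?_
      rw [ENNReal.rpow_two, ENNReal.ofReal_pow (le_max_right _ _)]
    simp_rw [h2] at h1
    refine h1.trans (liminf_le_of_le (by isBoundedDefault) fun b hb => ?_)
    obtain ⟨t, ht⟩ := hb.exists
    exact ht.trans (h i₀ (φ t))
  have hνP : ν ∈ PSpace d 2 := by
    rw [mem_PSpace_two]
    obtain ⟨R, hR⟩ := htail 1 one_pos
    refine (lintegral_enorm_sq_le_tailMoment R _).trans_lt ?_
    have : tailMoment R (ν : Measure (EuclideanSpace ℝ (Fin d))) ≠ ∞ :=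
      ne_top_of_le_ne_top ENNReal.one_ne_top (hνtail R 1 hR)
    finiteness
  -- The integrals already converge along the full sequence to a limit shared by all agents; the
  -- subsequence shows that this limit is the integral against `ν`.
  have hlim : ∀ {f : EuclideanSpace ℝ (Fin d) → ℝ}, IsDiffLipschitzConvex f → (∀ x, 0 ≤ f x) →
      (∀ x, f x ≤ 1) → ∀ i, Tendsto (fun t => ∫⁻ x, ENNReal.ofReal (f x)
        ∂(μ i t : Measure (EuclideanSpace ℝ (Fin d)))) atTop
        (𝓝 (∫⁻ x, ENNReal.ofReal (f x) ∂(ν : Measure (EuclideanSpace ℝ (Fin d))))) := by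
    intro f hf hf0 hf1 i
    obtain ⟨M, hM⟩ := hf.exists_tendsto_lintegral hμ hconv hf0
    have h1 := tendsto_lintegral_ofReal_of_bounded hν hf.continuous hf0 hf1
    rw [tendsto_nhds_unique h1 ((hM i₀).comp hφ.tendsto_atTop)]
    exact hM i
  -- Stated for two arbitrary sequences, so that it covers both two agents and an agent against the
  -- constant sequence `ν`.
  have hmain : ∀ m m' : ℕ → ProbabilityMeasure (EuclideanSpace ℝ (Fin d)),
      (∀ {f : EuclideanSpace ℝ (Fin d) → ℝ}, IsDiffLipschitzConvex f → (∀ x, 0 ≤ f x) →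
        (∀ x, f x ≤ 1) →
        Tendsto (fun t => ∫⁻ x, ENNReal.ofReal (f x)
          ∂(m t : Measure (EuclideanSpace ℝ (Fin d)))) atTop
          (𝓝 (∫⁻ x, ENNReal.ofReal (f x) ∂(ν : Measure (EuclideanSpace ℝ (Fin d))))) ∧
        Tendsto (fun t => ∫⁻ x, ENNReal.ofReal (f x)
          ∂(m' t : Measure (EuclideanSpace ℝ (Fin d)))) atTop
          (𝓝 (∫⁻ x, ENNReal.ofReal (f x) ∂(ν : Measure (EuclideanSpace ℝ (Fin d)))))) →
      (∀ (R : ℝ) (η : ℝ≥0∞), (∀ i t, tailMoment R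
        (μ i t : Measure (EuclideanSpace ℝ (Fin d))) ≤ η) → ∀ t,
        tailMoment R (m t : Measure (EuclideanSpace ℝ (Fin d))) ≤ η ∧
        tailMoment R (m' t : Measure (EuclideanSpace ℝ (Fin d))) ≤ η) →
      Tendsto (fun t => wasserstein 2 (m t) (m' t)) atTop (𝓝 0) := by
    intro m m' hmm' hmt
    refine tendsto_wasserstein_two_of_partition (fun η hη => ?_) (fun e η he hη => ?_)
    · obtain ⟨R, hR⟩ := htail η hη
      exact ⟨R, hmt R η hR⟩
    · obtain ⟨ε, hε0, hεe⟩ := ENNReal.lt_iff_exists_nnreal_btwn.1 he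
      have hε : (0 : ℝ) < ε := by exact_mod_cast hε0
      set y := TopologicalSpace.denseSeq (EuclideanSpace ℝ (Fin d))
      have hy : DenseRange y := TopologicalSpace.denseRange_denseSeq _
      have hdc : ∀ k, IsDiffLipschitzConvex (softPiece (ε : ℝ) y k) := fun k =>
        (isDiffLipschitzConvex_bumpMax hε y (k + 1)).sub (isDiffLipschitzConvex_bumpMax hε y k)
      have hmeas : ∀ k, Measurable fun x => ENNReal.ofReal (softPiece (ε : ℝ) y k x) :=
        fun k => (hdc k).continuous.measurable.ennreal_ofReal
      have hle1 : ∀ k x, softPiece (ε : ℝ) y k x ≤ 1 := fun k x => by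
        have h1 := bumpMax_le_one (ε : ℝ) y (k + 1) x
        have h2 := bumpMax_nonneg (ε : ℝ) y k x
        rw [softPiece]; linarith
      -- Finitely many pieces capture all but `η` of the mass of `ν`, by density of the centers and
      -- monotone convergence.
      have hN : ∃ N, 1 - ∫⁻ x, ENNReal.ofReal (bumpMax (ε : ℝ) y N x)
          ∂(ν : Measure (EuclideanSpace ℝ (Fin d))) < η := by
        have h := ENNReal.Tendsto.sub (tendsto_const_nhds (x := (1 : ℝ≥0∞)))
          (tendsto_lintegral_bumpMax hε hy (ν : Measure (EuclideanSpace ℝ (Fin d))))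
          (Or.inl ENNReal.one_ne_top)
        rw [tsub_self] at h
        exact (h.eventually_lt_const hη).exists
      obtain ⟨N, hN⟩ := hN
      refine ⟨N, fun k x => ENNReal.ofReal (softPiece (ε : ℝ) y k x), y,
        fun k => ∫⁻ x, ENNReal.ofReal (softPiece (ε : ℝ) y k x)
          ∂(ν : Measure (EuclideanSpace ℝ (Fin d))), hmeas, fun x => ?_, fun k x h => ?_,
        fun k => (hmm' (hdc k) (softPiece_nonneg _ y k) (hle1 k)).1,
        fun k => (hmm' (hdc k) (softPiece_nonneg _ y k) (hle1 k)).2, ?_⟩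
      · rw [sum_ofReal_softPiece, ENNReal.ofReal_le_one]
        exact bumpMax_le_one _ y N x
      · have h1 := dist_le_of_softPiece_ne_zero hε (y := y) (k := k) (x := x)
          fun h0 => h (by simp [h0])
        rw [dist_eq_norm] at h1
        refine le_trans ?_ hεe.le
        rw [← ofReal_norm, ← ENNReal.ofReal_coe_nnreal]
        exact ENNReal.ofReal_le_ofReal h1
      · rw [← lintegral_finsetSum _ fun k _ => hmeas k]
        simp_rw [sum_ofReal_softPiece]
        exact hN
  refine ⟨fun i j => hmain _ _ (fun hf hf0 hf1 => ⟨hlim hf hf0 hf1 i, hlim hf hf0 hf1 j⟩)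
    fun R η h t => ⟨h i t, h j t⟩, ν, hνP, fun i => hmain _ (fun _ => ν)
    (fun hf hf0 hf1 => ⟨hlim hf hf0 hf1 i, tendsto_const_nhds⟩)
    fun R η h t => ⟨h i t, hνtail R η h⟩⟩

end TailMoments

end WassersteinConsensus

theorem theorem1 (d n : ℕ) (hd : 0 < d) (hn : 0 < n)
    (G : ℕ → WassersteinConsensus.NetworkGraph n)
    (w : ℕ → Matrix (Fin n) (Fin n) ℝ)
    (hw : ∀ t, WassersteinConsensus.IsWeightedAdjacency (G t) (w t))
    (τ : ℕ → ℕ) (hτ_zero : τ 0 = 0) (hτ_mono : StrictMono τ)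
    (hτ_bdd : ∃ L : ℕ, ∀ k, τ (k + 1) - τ k ≤ L)
    (hconn : ∀ k,
      WassersteinConsensus.JointlyConnected (G '' Set.Ico (τ k) (τ (k + 1))))
    (δ : ℝ) (hδ : δ ∈ Set.Ioo (0 : ℝ) 1)
    (hw_lower : ∀ t i, ∀ j ∈ (G t).neighbors i, δ ≤ w t i j)
    (μ : Fin n → ℕ → ProbabilityMeasure (EuclideanSpace ℝ (Fin d)))
    (hμ_init : ∀ i, μ i 0 ∈ WassersteinConsensus.PSpaceAC d 2)
    (hμ_update : ∀ i t, μ i (t + 1) ∈ WassersteinConsensus.barycenters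
      ((G t).neighbors i) (fun j => μ j t) (fun j => w t i j)) :
    (∀ i j, Tendsto (fun t => WassersteinConsensus.wasserstein 2 (μ i t) (μ j t))
      atTop (𝓝 0)) ∧
    ∃ μstar ∈ WassersteinConsensus.PSpace d 2, ∀ i, ∀ p ∈ Set.Ico (1 : ℝ) 2,
      Tendsto (fun t => WassersteinConsensus.wasserstein p (μ i t) μstar)
        atTop (𝓝 0) := by
  open WassersteinConsensus in
  have : Nonempty (Fin n) := ⟨⟨0, hn⟩⟩
  obtain ⟨L, hL⟩ := hτ_bdd
  have hP : ∀ i t, μ i t ∈ PSpace d 2 := by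
    intro i t
    cases t with
    | zero => exact (hμ_init i).1
    | succ t => exact (hμ_update i t).1
  have hjensen : ∀ u : EuclideanSpace ℝ (Fin d) → ℝ, IsLipschitzConvex u → ∀ p : ℝ, 1 ≤ p →
      p ≤ 2 → ∀ i t, ∫⁻ x, ENNReal.ofReal (u x) ^ p
        ∂(μ i (t + 1) : Measure (EuclideanSpace ℝ (Fin d))) ≤
      ∑ j ∈ (G t).neighbors i, ENNReal.ofReal (w t i j) * ∫⁻ x, ENNReal.ofReal (u x) ^ p
        ∂(μ j t : Measure (EuclideanSpace ℝ (Fin d))) := by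
    rintro u ⟨-, huc, K, hK⟩ p hp1 hp2 i t
    exact lintegral_rpow_le_of_mem_barycenters (fun j hj => ((hw t).pos hj).le) ((hw t).2.2 i)
      (fun j _ => hP j t) (hμ_update i t) huc hK hp1 hp2
  have htail : ∀ η : ℝ≥0∞, 0 < η → ∃ R : ℝ, ∀ i t,
      tailMoment R (μ i t : Measure (EuclideanSpace ℝ (Fin d))) ≤ η := by
    intro η hη
    -- Only finitely many initial measures occur, so one radius serves all of them; Jensen's
    -- inequality then preserves the bound at each step.
    have h0 : ∀ᶠ R : ℕ in atTop, ∀ i,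
        tailMoment R (μ i 0 : Measure (EuclideanSpace ℝ (Fin d))) ≤ η :=
      eventually_all.2 fun i => ENNReal.tendsto_nhds_zero.1 (tendsto_tailMoment (hP i 0)) η hη
    obtain ⟨R, hR⟩ := h0.exists
    refine ⟨R, fun i t => ?_⟩
    induction t generalizing i with
    | zero => exact hR i
    | succ t ih =>
      have h := hjensen _ (isLipschitzConvex_norm_sub R) 2 one_le_two le_rfl i t
      simp_rw [← tailMoment_eq] at h
      calc _ ≤ _ := h
        _ ≤ ∑ j ∈ (G t).neighbors i, ENNReal.ofReal (w t i j) * η :=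
          Finset.sum_le_sum fun j _ => mul_le_mul_right (ih j) _
        _ = η := by
          rw [← Finset.sum_mul, sum_ofReal_eq_one (fun j hj => ((hw t).pos hj).le)
            ((hw t).2.2 i), one_mul]
  have hconv : ∀ u, IsLipschitzConvex u → ∃ M : ℝ≥0∞, M ≠ ∞ ∧ ∀ i, Tendsto (fun t =>
      ∫⁻ x, ENNReal.ofReal (u x) ∂(μ i t : Measure (EuclideanSpace ℝ (Fin d)))) atTop
      (𝓝 M) := by
    intro u hu
    -- All these integrals are finite, so the real-valued consensus theorem applies to their
    -- `toReal`.
    set a : ℕ → Fin n → ℝ := fun t i =>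
      (∫⁻ x, ENNReal.ofReal (u x) ∂(μ i t : Measure (EuclideanSpace ℝ (Fin d)))).toReal with ha
    have hfin := fun i t => hu.lintegral_ne_top (hP i t)
    obtain ⟨M, hM⟩ := exists_tendsto_of_le_average (a := a) hn hw hδ.1 hw_lower hτ_zero
      hτ_mono hL hconn (fun _ _ => ENNReal.toReal_nonneg) fun t i => by
        have h := hjensen u hu 1 le_rfl one_le_two i t
        simp only [ENNReal.rpow_one] at h
        have h2 := ENNReal.toReal_mono (ENNReal.sum_ne_top.2 fun j _ =>
          ENNReal.mul_ne_top ENNReal.ofReal_ne_top (hfin j t)) h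
        rw [ENNReal.toReal_sum fun j _ =>
          ENNReal.mul_ne_top ENNReal.ofReal_ne_top (hfin j t)] at h2
        refine h2.trans (le_of_eq (Finset.sum_congr rfl fun j hj => ?_))
        rw [ENNReal.toReal_mul, ENNReal.toReal_ofReal ((hw t).pos hj).le]
    refine ⟨ENNReal.ofReal M, ENNReal.ofReal_ne_top, fun i => ?_⟩
    refine (ENNReal.tendsto_ofReal (hM i)).congr fun t => ?_
    rw [ha, ENNReal.ofReal_toReal (hfin i t)]
  obtain ⟨h1, ν, hν, h2⟩ := exists_tendsto_wasserstein_of_convex hP htail hconv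
  exact ⟨h1, ν, hν, fun i p hp => tendsto_of_tendsto_of_tendsto_of_le_of_le tendsto_const_nhds
    (h2 i) (fun _ => zero_le) fun t =>
      wasserstein_le_wasserstein_two (by linarith [hp.1]) hp.2.le _ _⟩
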